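/- Let $F$ be a non-Archimedean, non-discrete, locally compact field with valuation ring $\mathfrak o$, maximal ideal $\mathfrak p$ and residue field of characteristic different from $2$, and let $G=\mathrm{PGL}(2,F)$ with its usual topology. Let $X$ be the Bruhat–Tits tree of $G$: its vertices are the homothety classes of full $\mathfrak o$-lattices in $F^2$, and two vertices form an edge if and only if they can be written $[\mathfrak o e_1\oplus\mathfrak o e_2]$ and $[\mathfrak o e_1\oplus\mathfrak p e_2]$ for some basis $(e_1,e_2)$ of $F^2$. For $k\ge 1$, an oriented $k$-path in $X$ is an injective sequence of vertices $(s_0,\dots,s_k)$ in which consecutive vertices are joined by an edge. For $n\ge 1$ let $\tilde X_n$ be the graph whose vertices are the oriented $n$-paths of $X$ and whose edges are the oriented $(n+1)$-paths of $X$, the path $(s_0,\dots,s_{n+1})$ joining $(s_0,\dots,s_n)$ to $(s_1,\dots,s_{n+1})$. The group $G$ acts on $X$ and on every $\tilde X_n$. For a locally finite graph $\Sigma$ let $H^1_c(\Sigma)$ be the quotient of the space of finitely supported functions $\omega$ on the oriented edges of $\Sigma$ with values in $\mathbb C$ and with $\omega([a,b])=-\omega([b,a])$, by the space of coboundaries $df([a,b])=f(b)-f(a)$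 of finitely supported functions $f$ from the vertices of $\Sigma$ to $\mathbb C$; if $\Sigma$ is finite write $H^1(\Sigma)$ for it. A group acting on $\Sigma$ acts linearly on this space. Let $m\ge 1$, and let $p:\tilde X_{2m}\to X$ be the projection given on vertices by $p(s_{-m},\dots,s_0,\dots,s_m)=s_0$. For an edge $e$ of $X$ let $\tilde X_e=p^{-1}(e)$ denote the finite subgraph of $\tilde X_{2m}$ formed of the edges that $p$ maps onto $e$, together with their end points. **Proposition 3.5.** For every $m\ge 1$ and every (unoriented) edge $e_0$ of $X$, with $\mathcal K_{e_0}$ the stabilizer of $e_0$ in $G$, there is an isomorphism of $G$-modules $$H^1_c(\tilde X_{2m})\;\simeq\; H^1_c(\tilde X_{2m-1})\;\oplus\;\text{c-Ind}_{\mathcal K_{e_0}}^{G} H^1(\tilde X_{e_0}).$$ Here $\text{c-Ind}_{\mathcal K}^{G}W$ is the space of functions $f:G\to W$ with $f(kg)=k\cdot f(g)$ for $k\in\mathcal K$, $g\in G$, that are invariant under right translation by some open subgroup of $G$ and whose support is contained in $\mathcal K C$ for some compact $C\subseteq G$; the group $G$ acts on it by right translation. -/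

import Mathlib

open scoped ValuativeRel Pointwise MatrixGroups

noncomputable section

namespace BTGraph

/-! ### Cohomology with compact support of a graph -/

section Cohomology

variable {V : Type*} (Γ : SimpleGraph V)

/-- Finitely supported `0`-cochains of the graph `Γ`, with complex coefficients. -/
def cochain0 (V : Type*) : Submodule ℂ (V → ℂ) where
  carrier := {f | f.support.Finite}
  zero_mem' := by simp
  add_mem' := fun {f g} hf hg =>
    (hf.union hg).subset (Function.support_add f g)
  smul_mem' := fun c f hf => hf.subset (Function.support_const_smul_subset c f)

/-- Finitely supported oriented `1`-cochains of the graph `Γ`: functions `ω` on the set of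
oriented edges with `ω [a,b] = - ω [b,a]`. -/
def cochain1 : Submodule ℂ (Γ.Dart → ℂ) where
  carrier := {ω | ω.support.Finite ∧ ∀ a : Γ.Dart, ω a = - ω a.symm}
  zero_mem' := by simp
  add_mem' := fun {f g} hf hg =>
    ⟨(hf.1.union hg.1).subset (Function.support_add f g), fun a => by
      simp only [Pi.add_apply, hf.2 a, hg.2 a]; ring⟩
  smul_mem' := fun c f hf =>
    ⟨hf.1.subset (Function.support_const_smul_subset c f), fun a => by
      simp only [Pi.smul_apply, smul_eq_mul, hf.2 a]; ring⟩

/-- The coboundary map `(d f) [a,b] = f b - f a`. -/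
def coboundary : (V → ℂ) →ₗ[ℂ] (Γ.Dart → ℂ) where
  toFun f a := f a.snd - f a.fst
  map_add' f g := by ext a; simp only [Pi.add_apply]; ring
  map_smul' c f := by ext a; simp only [Pi.smul_apply, smul_eq_mul, RingHom.id_apply]; ring

/-- On a locally finite graph the coboundary of a finitely supported `0`-cochain is a finitely
supported `1`-cochain. -/
theorem map_coboundary_le (hΓ : ∀ v, (Γ.neighborSet v).Finite) :
    (cochain0 V).map (coboundary Γ) ≤ cochain1 Γ := by
  rintro _ ⟨f, hf, rfl⟩
  refine ⟨?_, fun a => by simp [coboundary]⟩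
  have hf' : f.support.Finite := hf
  have hfin : (⋃ v ∈ f.support, (fun w => (v, w)) '' Γ.neighborSet v).Finite :=
    hf'.biUnion fun v _ => (hΓ v).image _
  have hfin2 := hfin.union (hfin.image Prod.swap)
  refine (hfin2.preimage (f := SimpleGraph.Dart.toProd)
    (SimpleGraph.Dart.toProd_injective.injOn)).subset ?_
  intro a ha
  by_cases h1 : f a.fst = 0
  · have h2 : f a.snd ≠ 0 := by
      intro h2; apply ha; simp [coboundary, h1, h2]
    right
    refine ⟨(a.snd, a.fst), ?_, rfl⟩
    simp only [Set.mem_iUnion]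
    exact ⟨a.snd, h2, a.fst, a.adj.symm, rfl⟩
  · left
    simp only [Set.mem_iUnion]
    exact ⟨a.fst, h1, a.snd, a.adj, rfl⟩

/-- `H¹_c(Γ, ℂ)` for a locally finite graph `Γ`: finitely supported `1`-cochains modulo the
coboundaries of finitely supported `0`-cochains. When `Γ` is finite this is `H¹(Γ, ℂ)`. -/
abbrev H1c : Type _ :=
  cochain1 Γ ⧸ ((cochain0 V).map (coboundary Γ)).comap (cochain1 Γ).subtype

end Cohomology

/-! ### Group actions on graphs, and the resulting representations on cohomology -/

/-- The action of `H` on the vertex set is simplicial. -/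
class GraphAction (H : Type*) {V : Type*} [Group H] [MulAction H V] (Γ : SimpleGraph V) :
    Prop where
  adj_smul : ∀ (h : H) (x y : V), Γ.Adj x y → Γ.Adj (h • x) (h • y)

section Action

variable (H : Type*) {V : Type*} [Group H] [MulAction H V] (Γ : SimpleGraph V)

/-- The action on oriented edges. -/
instance dartAction [GraphAction H Γ] : MulAction H Γ.Dart where
  smul h a := ⟨(h • a.fst, h • a.snd), GraphAction.adj_smul h _ _ a.adj⟩
  one_smul a := SimpleGraph.Dart.ext _ _ (Prod.ext (one_smul H a.fst) (one_smul H a.snd))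
  mul_smul g h a :=
    SimpleGraph.Dart.ext _ _ (Prod.ext (mul_smul g h a.fst) (mul_smul g h a.snd))

/-- The representation of `H` on complex functions on an `H`-set: `(h f)(x) = f (h⁻¹ x)`. -/
def funRep (X : Type*) [MulAction H X] : Representation ℂ H (X → ℂ) where
  toFun h := LinearMap.funLeft ℂ ℂ (fun x => h⁻¹ • x)
  map_one' := by ext; simp [LinearMap.funLeft]
  map_mul' g h := by
    apply LinearMap.ext; intro f; funext x
    simp [LinearMap.funLeft, mul_smul]

theorem funRep_support {X : Type*} [MulAction H X] (h : H) {f : X → ℂ} (hf : f.support.Finite) :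
    (funRep H X h f).support.Finite :=
  hf.preimage (f := fun x => h⁻¹ • x) (MulAction.injective h⁻¹).injOn

/-- The representation of `H` on finitely supported `1`-cochains. -/
def cochain1Rep [GraphAction H Γ] : Representation ℂ H (cochain1 Γ) :=
  (funRep H Γ.Dart).subrepresentation (cochain1 Γ) fun h _ hω =>
    ⟨funRep_support H h hω.1, fun a => hω.2 (h⁻¹ • a)⟩

/-- The representation of `H` on `H¹_c(Γ, ℂ)`. -/
def H1cRep [GraphAction H Γ] : Representation ℂ H (H1c Γ) :=
  (cochain1Rep H Γ).quotient _ <| by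
    rintro h ω ⟨f, hf, hfω⟩
    refine ⟨funRep H V h f, funRep_support H h hf, ?_⟩
    funext a
    exact congrFun hfω (h⁻¹ • a)

end Action

/-! ### Oriented paths and the tower of graphs over a graph -/

section Tower

variable {V : Type*} (X : SimpleGraph V)

/-- Oriented `k`-paths in `X`: injective sequences of vertices `(s₀, …, s_k)` such that
`{s_i, s_{i+1}}` is an edge for `0 ≤ i < k`. -/
@[ext]
structure OrientedPath (k : ℕ) where
  vert : Fin (k + 1) → V
  injective : Function.Injective vert
  adj : ∀ i : Fin k, X.Adj (vert i.castSucc) (vert i.succ)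

variable {X}

/-- `(s₀, …, s_{n+1}) ↦ (s₀, …, s_n)`. -/
def OrientedPath.tail {n : ℕ} (a : OrientedPath X (n + 1)) : OrientedPath X n where
  vert i := a.vert i.castSucc
  injective := a.injective.comp (Fin.castSucc_injective _)
  adj i := a.adj i.castSucc

/-- `(s₀, …, s_{n+1}) ↦ (s₁, …, s_{n+1})`. -/
def OrientedPath.head {n : ℕ} (a : OrientedPath X (n + 1)) : OrientedPath X n where
  vert i := a.vert i.succ
  injective := a.injective.comp (Fin.succ_injective _)
  adj i := a.adj i.succ

variable (X)

/-- The `1`-dimensional simplicial complex `X̃_n` (for `n ≥ 1`). Its vertices are the oriented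
`n`-paths of `X`; its edges are the oriented `(n+1)`-paths `a`, such an `a` joining its tail `a⁻`
to its head `a⁺`. -/
def tower (n : ℕ) : SimpleGraph (OrientedPath X n) where
  Adj v w := ∃ a : OrientedPath X (n + 1), (a.tail = v ∧ a.head = w) ∨ (a.tail = w ∧ a.head = v)
  symm := ⟨fun _ _ ⟨a, ha⟩ => ⟨a, ha.symm⟩⟩
  loopless := ⟨by
    rintro v ⟨a, ha⟩
    have h : a.tail = a.head := by
      rcases ha with ha | ha <;> exact ha.1.trans ha.2.symm
    have h0 : a.vert (Fin.castSucc 0) = a.vert (Fin.succ 0) :=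
      congrFun (congrArg OrientedPath.vert h) 0
    exact (X.ne_of_adj (a.adj 0)) h0⟩

/-- For `n ≥ 1` an unordered pair of vertices of `X̃_n` is joined by at most one oriented
`(n+1)`-path, so nothing is lost in regarding `X̃_n` as a simple graph. -/
theorem tower_edge_unique {n : ℕ} (hn : 1 ≤ n) (a b : OrientedPath X (n + 1))
    (h : (a.tail = b.tail ∧ a.head = b.head) ∨ (a.tail = b.head ∧ a.head = b.tail)) : a = b := by
  rcases h with ⟨h1, h2⟩ | ⟨h1, h2⟩
  · ext i
    refine Fin.cases ?_ (fun j => ?_) i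
    · exact congrFun (congrArg OrientedPath.vert h1) 0
    · exact congrFun (congrArg OrientedPath.vert h2) j
  · exfalso
    have e1 : a.vert (Fin.castSucc 0) = b.vert (Fin.succ 0) :=
      congrFun (congrArg OrientedPath.vert h1) 0
    have e2 : a.vert (Fin.succ ⟨1, by omega⟩) = b.vert (Fin.castSucc ⟨1, by omega⟩) :=
      congrFun (congrArg OrientedPath.vert h2) ⟨1, by omega⟩
    have e3 : (Fin.succ 0 : Fin (n + 2)) = Fin.castSucc ⟨1, by omega⟩ := by ext; simp
    have e4 := a.injective (e1.trans ((congrArg b.vert e3).trans e2.symm))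
    simp [Fin.ext_iff] at e4

/-- The projection `X̃_{2m} → X`, given on vertices by `(s_{-m}, …, s_0, …, s_m) ↦ s_0`. -/
def proj (m : ℕ) (v : OrientedPath X (2 * m)) : V := v.vert ⟨m, by omega⟩

/-- The fibre `X̃_e` of `X̃_{2m}` over an edge `e` of `X`: the subcomplex of `X̃_{2m}` formed of
the edges which `proj` maps onto `e`, together with their end points. -/
def fibre (m : ℕ) (e : Sym2 V) : (tower X (2 * m)).Subgraph where
  verts := {v | ∃ w, (tower X (2 * m)).Adj v w ∧ s(proj X m v, proj X m w) = e}
  Adj v w := (tower X (2 * m)).Adj v w ∧ s(proj X m v, proj X m w) = e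
  adj_sub h := h.1
  edge_vert {_ w} h := ⟨w, h⟩
  symm := ⟨fun _ _ h => ⟨h.1.symm, Sym2.eq_swap.trans h.2⟩⟩

variable {X} (H : Type*) [Group H] [MulAction H V] [GraphAction H X]

instance pathAction (k : ℕ) : MulAction H (OrientedPath X k) where
  smul h v := ⟨fun i => h • v.vert i, (MulAction.injective h).comp v.injective,
    fun i => GraphAction.adj_smul h _ _ (v.adj i)⟩
  one_smul v := OrientedPath.ext (funext fun i => one_smul H (v.vert i))
  mul_smul g h v := OrientedPath.ext (funext fun i => mul_smul g h (v.vert i))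

instance towerGraphAction (n : ℕ) : GraphAction H (tower X n) where
  adj_smul h v w := by
    rintro ⟨a, ⟨rfl, rfl⟩ | ⟨rfl, rfl⟩⟩
    · exact ⟨h • a, Or.inl ⟨rfl, rfl⟩⟩
    · exact ⟨h • a, Or.inr ⟨rfl, rfl⟩⟩

/-- The (global) stabilizer in `H` of an unoriented edge. -/
def edgeStabilizer (e : Sym2 V) : Subgroup H where
  carrier := {h | e.map (h • ·) = e}
  one_mem' := by simp
  mul_mem' := fun {g h} hg hh => by
    have hg' : e.map (g • ·) = e := hg
    have hh' : e.map (h • ·) = e := hh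
    change e.map ((g * h) • ·) = e
    have : ((g * h) • · : V → V) = (g • ·) ∘ (h • ·) := funext fun x => mul_smul g h x
    rw [this, ← Sym2.map_map, hh', hg']
  inv_mem' := fun {g} hg => by
    have hg' : e.map (g • ·) = e := hg
    change e.map (g⁻¹ • ·) = e
    conv_lhs => rw [← hg', Sym2.map_map]
    have : ((g⁻¹ • ·) ∘ (g • ·) : V → V) = id := funext fun x => inv_smul_smul g x
    rw [this, Sym2.map_id, id]

theorem fibre_smul {m : ℕ} {e : Sym2 V} (h : edgeStabilizer H e) {v w : OrientedPath X (2 * m)}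
    (hvw : (fibre X m e).Adj v w) : (fibre X m e).Adj (h.1 • v) (h.1 • w) := by
  refine ⟨GraphAction.adj_smul _ _ _ hvw.1, ?_⟩
  have h1 : e.map (h.1 • ·) = e := h.2
  have h2 : s(proj X m (h.1 • v), proj X m (h.1 • w)) =
      Sym2.map (h.1 • ·) s(proj X m v, proj X m w) := rfl
  rw [h2, hvw.2, h1]

/-- The stabilizer of `e` acts on the fibre over `e`. -/
instance fibreAction (m : ℕ) (e : Sym2 V) :
    MulAction (edgeStabilizer H e) (fibre X m e).verts where
  smul h v := ⟨h.1 • v.1, by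
    obtain ⟨w, hw⟩ := v.2
    exact ⟨h.1 • w, fibre_smul H h hw⟩⟩
  one_smul v := Subtype.ext (one_smul H v.1)
  mul_smul g h v := Subtype.ext (mul_smul g.1 h.1 v.1)

instance fibreGraphAction (m : ℕ) (e : Sym2 V) :
    GraphAction (edgeStabilizer H e) (fibre X m e).coe where
  adj_smul h _ _ hvw := fibre_smul H h hvw

end Tower

/-! ### Compact induction -/

section CompactInduction

variable {G : Type*} [Group G] [TopologicalSpace G] [IsTopologicalGroup G]
  (K : Subgroup G) {W : Type*} [AddCommGroup W] [Module ℂ W] (σ : Representation ℂ K W)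

/-- The space of `c-Ind_K^G σ`: functions `f : G → W` with `f (k g) = σ(k) f(g)` for `k ∈ K`, which
are invariant under right translation by some open subgroup of `G`, and whose support is compact
modulo `K`. -/
def cIndSpace : Submodule ℂ (G → W) where
  carrier := {f | (∀ (k : K) (g : G), f (k * g) = σ k (f g)) ∧
    (∃ U : Subgroup G, IsOpen (U : Set G) ∧ ∀ u ∈ U, ∀ g, f (g * u) = f g) ∧
    ∃ C : Set G, IsCompact C ∧ f.support ⊆ (K : Set G) * C}
  zero_mem' := ⟨by simp, ⟨⊤, by simp, by simp⟩, ∅, by simp, by simp⟩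
  add_mem' := by
    rintro f f' ⟨h1, ⟨U, hU, h2⟩, C, hC, h3⟩ ⟨h1', ⟨U', hU', h2'⟩, C', hC', h3'⟩
    refine ⟨fun k g => by simp [h1, h1'], ⟨U ⊓ U', hU.inter hU', fun u hu g => ?_⟩,
      C ∪ C', hC.union hC', ?_⟩
    · simp [h2 u hu.1 g, h2' u hu.2 g]
    · rw [Set.mul_union]
      exact (Function.support_add f f').trans (Set.union_subset_union h3 h3')
  smul_mem' := by
    rintro c f ⟨h1, ⟨U, hU, h2⟩, C, hC, h3⟩
    exact ⟨fun k g => by simp [h1], ⟨U, hU, fun u hu g => by simp [h2 u hu g]⟩,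
      C, hC, (Function.support_const_smul_subset c f).trans h3⟩

/-- The representation of `G` on functions on `G` by right translation. -/
def rightTranslation (G : Type*) [Group G] (W : Type*) [AddCommGroup W] [Module ℂ W] :
    Representation ℂ G (G → W) where
  toFun g := LinearMap.funLeft ℂ W (· * g)
  map_one' := by apply LinearMap.ext; intro f; funext x; simp [LinearMap.funLeft]
  map_mul' g h := by
    apply LinearMap.ext; intro f; funext x; simp [LinearMap.funLeft, mul_assoc]

/-- The compactly induced representation `c-Ind_K^G σ`; `G` acts by right translation. -/
def cInd : Representation ℂ G (cIndSpace K σ) :=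
  (rightTranslation G W).subrepresentation (cIndSpace K σ) <| by
    rintro x f ⟨h1, ⟨U, hU, h2⟩, C, hC, h3⟩
    refine ⟨fun k g => ?_, ⟨U.comap (MulAut.conj x⁻¹).toMonoidHom, ?_, fun u hu g => ?_⟩,
      (· * x⁻¹) '' C, hC.image (continuous_mul_const _), fun g hg => ?_⟩
    · change f (k * g * x) = σ k (f (g * x))
      rw [mul_assoc, h1]
    · refine hU.preimage (f := fun u => x⁻¹ * u * x⁻¹⁻¹) (by fun_prop)
    · change f (g * u * x) = f (g * x)
      have hu' : x⁻¹ * u * x⁻¹⁻¹ ∈ U := hu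
      have := h2 _ hu' (g * x)
      rw [← this]
      congr 1
      group
    · obtain ⟨k, hk, c, hc, hkc⟩ := h3 (show f (g * x) ≠ 0 from hg)
      exact ⟨k, hk, c * x⁻¹, ⟨c, hc, rfl⟩, by
        change k * (c * x⁻¹) = g
        have hkc' : k * c = g * x := hkc
        rw [← mul_assoc, hkc', mul_inv_cancel_right]⟩

end CompactInduction

/-! ### The topological group `PGL(2, F)` and its Bruhat–Tits tree -/

section PGL

/-- The quotient topology on `PGL(n, F)`. -/
instance pglTopologicalSpace (n : ℕ) (F : Type*) [Field F] [TopologicalSpace F] :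
    TopologicalSpace PGL(n, F) :=
  inferInstanceAs (TopologicalSpace (GL (Fin n) F ⧸ Subgroup.center (GL (Fin n) F)))

instance pglIsTopologicalGroup (n : ℕ) (F : Type*) [Field F] [TopologicalSpace F]
    [IsTopologicalRing F] : IsTopologicalGroup PGL(n, F) :=
  inferInstanceAs (IsTopologicalGroup (GL (Fin n) F ⧸ Subgroup.center (GL (Fin n) F)))

variable (F : Type*) [Field F] [ValuativeRel F]

/-- Full `𝒪`-lattices in `F²`. -/
def Lattice : Type _ := {L : Submodule 𝒪[F] (Fin 2 → F) // L.IsLattice F}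

variable {F} in
theorem isLattice_smul (g : GL (Fin 2) F) {L : Submodule 𝒪[F] (Fin 2 → F)} (hL : L.IsLattice F) :
    (g • L).IsLattice F where
  fg := hL.fg.map _
  span_eq_top := by
    refine eq_top_iff.mpr fun x _ => ?_
    have hx : g⁻¹ • x ∈ Submodule.span F (L : Set (Fin 2 → F)) := by
      rw [hL.span_eq_top]; trivial
    have key : ∀ y ∈ Submodule.span F (L : Set (Fin 2 → F)),
        g • y ∈ Submodule.span F ((g • L : Submodule 𝒪[F] (Fin 2 → F)) : Set (Fin 2 → F)) := by
      intro y hy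
      induction hy using Submodule.span_induction with
      | mem y hy => exact Submodule.subset_span (Submodule.smul_mem_pointwise_smul _ _ _ hy)
      | zero => rw [smul_zero]; exact Submodule.zero_mem _
      | add a b _ _ ha hb => rw [smul_add]; exact Submodule.add_mem _ ha hb
      | smul c a _ ha => rw [smul_comm]; exact Submodule.smul_mem _ _ ha
    simpa only [smul_inv_smul] using key _ hx

instance latticeAction : MulAction (GL (Fin 2) F) (Lattice F) where
  smul g L := ⟨g • L.1, isLattice_smul g L.2⟩
  one_smul L := Subtype.ext (one_smul _ L.1)
  mul_smul g h L := Subtype.ext (mul_smul g h L.1)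

/-- Homothety of lattices: `M = c L` for some `c ∈ Fˣ`. -/
instance homothety : Setoid (Lattice F) where
  r L M := ∃ c : Fˣ, M.1 = c • L.1
  iseqv :=
    { refl := fun L => ⟨1, (one_smul _ L.1).symm⟩
      symm := fun {L M} ⟨c, hc⟩ => ⟨c⁻¹, by rw [hc, inv_smul_smul]⟩
      trans := fun {L M N} ⟨c, hc⟩ ⟨d, hd⟩ => ⟨d * c, by rw [hd, hc, mul_smul]⟩ }

/-- Vertices of the Bruhat–Tits tree: homothety classes of full lattices in `F²`. -/
def Vertex : Type _ := Quotient (homothety F)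

variable {F} in
theorem smul_smul_lattice (g : GL (Fin 2) F) (c : Fˣ) (L : Submodule 𝒪[F] (Fin 2 → F)) :
    g • c • L = c • g • L := by
  ext x
  constructor
  · rintro ⟨_, ⟨y, hy, rfl⟩, rfl⟩
    exact ⟨g • y, ⟨y, hy, rfl⟩, smul_comm _ _ _⟩
  · rintro ⟨_, ⟨y, hy, rfl⟩, rfl⟩
    exact ⟨c • y, ⟨y, hy, rfl⟩, smul_comm _ _ _⟩

instance glVertexAction : MulAction (GL (Fin 2) F) (Vertex F) where
  smul g := Quotient.map (g • ·) fun L M ⟨c, hc⟩ => ⟨c, by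
    change g • M.1 = c • g • L.1
    rw [hc, smul_smul_lattice]⟩
  one_smul := by
    rintro ⟨L⟩
    exact congrArg (Quotient.mk _) (one_smul _ L)
  mul_smul g h := by
    rintro ⟨L⟩
    exact congrArg (Quotient.mk _) (mul_smul g h L)

/-- The action of `PGL(2, F)` on vertices induced by the action of `GL(2, F)` on lattices. -/
instance vertexAction : MulAction PGL(2, F) (Vertex F) :=
  Matrix.ProjGenLinGroup.mulActionOfGL <| by
    rintro u ⟨L⟩
    refine Quotient.sound (Setoid.symm ⟨u, ?_⟩)
    change Matrix.GeneralLinearGroup.scalar (Fin 2) u • L.1 = u • L.1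
    have h : ∀ y : Fin 2 → F, Matrix.GeneralLinearGroup.scalar (Fin 2) u • y = u • y := by
      intro y
      simp [Units.smul_def]
    ext x
    constructor
    · rintro ⟨y, hy, rfl⟩
      exact ⟨y, hy, (h y).symm⟩
    · rintro ⟨y, hy, rfl⟩
      exact ⟨y, hy, h y⟩

variable {F} in
/-- `L = 𝒪 e₁ ⊕ 𝒪 e₂` and `M = 𝒪 e₁ ⊕ 𝔭 e₂` for some basis `(e₁, e₂)` of `F²`. -/
def LatticeAdj (L M : Lattice F) : Prop :=
  ∃ b : Module.Basis (Fin 2) F (Fin 2 → F),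
    L.1 = Submodule.span 𝒪[F] {b 0} ⊔ Submodule.span 𝒪[F] {b 1} ∧
    M.1 = Submodule.span 𝒪[F] {b 0} ⊔ 𝓂[F] • Submodule.span 𝒪[F] {b 1}

variable {F} in
/-- The action of `GL(2, F)` preserves `LatticeAdj`. -/
theorem LatticeAdj.smul {L M : Lattice F} (h : LatticeAdj L M) (g : GL (Fin 2) F) :
    LatticeAdj (g • L) (g • M) := by
  obtain ⟨b, hL, hM⟩ := h
  have hspan : ∀ x : Fin 2 → F,
      g • Submodule.span 𝒪[F] {x} = Submodule.span 𝒪[F] {g • x} := fun x => by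
    rw [← Set.smul_set_singleton]; exact Submodule.map_span _ _
  have hsup : ∀ A B : Submodule 𝒪[F] (Fin 2 → F), g • (A ⊔ B) = g • A ⊔ g • B :=
    fun A B => Submodule.map_sup A B _
  have hid : ∀ A : Submodule 𝒪[F] (Fin 2 → F), g • 𝓂[F] • A = 𝓂[F] • g • A :=
    fun A => Submodule.map_smul'' 𝓂[F] A _
  refine ⟨b.map (DistribMulAction.toLinearEquiv F _ g), ?_, ?_⟩
  · change g • L.1 = _
    rw [hL, hsup, hspan, hspan]; rfl
  · change g • M.1 = _
    rw [hM, hsup, hid, hspan, hspan]; rfl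

section LocalField

variable [TopologicalSpace F] [IsNonarchimedeanLocalField F]

variable {F} in
theorem maximalIdeal_smul_span {ϖ : 𝒪[F]} (hϖ : Irreducible ϖ) (x : Fin 2 → F) :
    𝓂[F] • Submodule.span 𝒪[F] {x} = Submodule.span 𝒪[F] {ϖ • x} := by
  rw [hϖ.maximalIdeal_eq, Submodule.ideal_span_singleton_smul, Submodule.smul_span,
    Set.smul_set_singleton]

variable {F} in
/-- `LatticeAdj` is symmetric up to homothety. -/
theorem LatticeAdj.symm {L M : Lattice F} (h : LatticeAdj L M) :
    ∃ L' : Lattice F, L ≈ L' ∧ LatticeAdj M L' := by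
  obtain ⟨b, hL, hM⟩ := h
  obtain ⟨ϖ, hϖ⟩ := IsDiscreteValuationRing.exists_irreducible 𝒪[F]
  have hϖ0 : (ϖ : F) ≠ 0 := fun h0 => hϖ.ne_zero (Subtype.ext h0)
  have hspan : ∀ x : Fin 2 → F, Units.mk0 (ϖ : F) hϖ0 • Submodule.span 𝒪[F] {x} =
      Submodule.span 𝒪[F] {ϖ • x} := fun x => by
    have h := Submodule.map_span (DistribSMul.toLinearMap 𝒪[F] (Fin 2 → F)
      (Units.mk0 (ϖ : F) hϖ0)) {x}
    rw [Set.image_singleton] at h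
    exact h
  have hL' := hL
  refine ⟨⟨Units.mk0 (ϖ : F) hϖ0 • L.1, @Submodule.IsLattice.smul _ _ _ _ _ _ _ _ _ _ _ L.2 _⟩,
    ⟨_, rfl⟩, (b.unitsSMul ![1, Units.mk0 (ϖ : F) hϖ0]).reindex (Equiv.swap 0 1), ?_, ?_⟩
  · rw [hM, maximalIdeal_smul_span hϖ, sup_comm]
    simp [Module.Basis.unitsSMul_apply]
    rfl
  · change Units.mk0 (ϖ : F) hϖ0 • L.1 = _
    rw [hL, maximalIdeal_smul_span hϖ, sup_comm]
    refine (Submodule.map_sup _ _ _).trans ?_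
    refine (congrArg₂ (· ⊔ ·) (hspan (b 1)) (hspan (b 0))).trans ?_
    simp [Module.Basis.unitsSMul_apply]
    rfl

variable {F} in
/-- Lattices related by `LatticeAdj` are not homothetic. -/
theorem LatticeAdj.not_equiv {L M : Lattice F} (h : LatticeAdj L M) : ¬ L ≈ M := by
  rintro ⟨c, hc⟩
  obtain ⟨b, hL, hM⟩ := h
  obtain ⟨ϖ, hϖ⟩ := IsDiscreteValuationRing.exists_irreducible 𝒪[F]
  rw [maximalIdeal_smul_span hϖ] at hM
  have hb0 : b 0 ∈ c • L.1 := by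
    rw [← hc, hM]
    exact Submodule.mem_sup_left (Submodule.mem_span_singleton_self _)
  obtain ⟨y, hy, hy0⟩ := hb0
  have hy' : y ∈ L.1 := hy
  have hb1 : c • b 1 ∈ M.1 := by
    rw [hc, hL]
    exact ⟨b 1, Submodule.mem_sup_right (Submodule.mem_span_singleton_self _), rfl⟩
  rw [hL] at hy'
  rw [hM] at hb1
  obtain ⟨_, h1, _, h2, rfl⟩ := Submodule.mem_sup.mp hy'
  obtain ⟨_, h3, _, h4, h5⟩ := Submodule.mem_sup.mp hb1
  obtain ⟨a1, rfl⟩ := Submodule.mem_span_singleton.mp h1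
  obtain ⟨a2, rfl⟩ := Submodule.mem_span_singleton.mp h2
  obtain ⟨a3, rfl⟩ := Submodule.mem_span_singleton.mp h3
  obtain ⟨a4, rfl⟩ := Submodule.mem_span_singleton.mp h4
  have e1 : (c : F) * a1 = 1 := by
    have := congrArg (fun z => b.repr z 0) hy0
    simpa [Units.smul_def, Subring.smul_def] using this
  have e2 : (a4 : F) * ϖ = c := by
    have := congrArg (fun z => b.repr z 1) h5
    simpa [Units.smul_def, Subring.smul_def] using this
  refine hϖ.not_isUnit (IsUnit.of_mul_eq_one (a4 * a1) (Subtype.ext ?_))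
  change (ϖ : F) * (a4 * a1) = 1
  rw [← e1, ← e2]; ring

/-- The Bruhat–Tits tree of `PGL(2, F)`: two vertices `x`, `y` form an edge if and only if
`x = [𝒪 e₁ ⊕ 𝒪 e₂]` and `y = [𝒪 e₁ ⊕ 𝔭 e₂]` for some basis `(e₁, e₂)` of `F²`. -/
def tree : SimpleGraph (Vertex F) where
  Adj x y := ∃ L M : Lattice F, x = Quotient.mk _ L ∧ y = Quotient.mk _ M ∧ LatticeAdj L M
  symm := ⟨by
    rintro _ _ ⟨L, M, rfl, rfl, h⟩
    obtain ⟨L', hL', h'⟩ := h.symm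
    exact ⟨M, L', rfl, Quotient.sound hL', h'⟩⟩
  loopless := ⟨by
    rintro _ ⟨L, M, rfl, hM, h⟩
    exact h.not_equiv (Quotient.exact hM)⟩

instance treeGraphAction : GraphAction PGL(2, F) (tree F) where
  adj_smul g := by
    induction g using Matrix.ProjGenLinGroup.induction_on with | mk g =>
    rintro _ _ ⟨L, M, rfl, rfl, h⟩
    exact ⟨g • L, g • M, rfl, rfl, h.smul g⟩

end LocalField

end PGL

end BTGraph

end

noncomputable section

namespace BTGraph

/-! ### Lattices and the Bruhat–Tits tree -/

section TreeGeometry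

variable {F : Type*} [Field F] [ValuativeRel F]

/-! For `n ≥ 1` the oriented edges of `X̃_{n+1}` are the pairs of `(n+1)`-paths `(a, b)` with
`a.head = b.tail`: since the tree is acyclic, such paths always join (`exists_join`). The edges thus
split into complete bipartite blocks indexed by the common `n`-path `c`, and a 1-cochain is a family
of matrices, one per block. Each matrix is uniquely the sum of a harmonic one (zero row and column
sums) and one of the form `u b - v a` (`exists_harmonic_decomposition`, `harmonic_eq_zero`).
Subtracting the coboundary of `v` turns `u b - v a` into `(u - v) b`, a function on the edges of
`X̃_n`; shifting `u` and `v` by a common constant on each block changes it by a coboundary of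
`X̃_n`. Hence `H¹_c(X̃_{n+1})` is `H¹_c(X̃_n)` plus the harmonic cochains, equivariantly
(`headPullEquiv`).

When `n + 1 = 2m`, the block of `c` lies over the middle edge of `c`. Over a fixed edge `e` no
vertex is both a source and a target (`midEdge_tail_ne_midEdge_head`), so `u` and `v` glue to a
single function on the fibre, and `H¹(X̃_e)` is exactly the space of harmonic matrices on the blocks
over `e` (`exists_harmonic_fibreRestrict_eq`, `harmonic_eq_zero_of_fibreRestrict`). Harmonic
cochains are therefore the direct sum of the `H¹(X̃_e)` over all edges `e`. The group permutes the
edges transitively with open stabilizers, so this sum is the compact induction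
(`harmonicEquivCInd`).

All that is used of the tree is local finiteness, absence of leaves and of closed walks without
backtracking (`LeaflessTree`), transitivity on edges and openness of vertex stabilizers. -/

theorem scalar_smul_lattice (c : Fˣ) (L : Submodule 𝒪[F] (Fin 2 → F)) :
    Matrix.GeneralLinearGroup.scalar (Fin 2) c • L = c • L := by
  have h : ∀ y : Fin 2 → F, Matrix.GeneralLinearGroup.scalar (Fin 2) c • y = c • y := by
    intro y
    simp [Units.smul_def]
  ext x
  constructor
  · rintro ⟨y, hy, rfl⟩
    exact ⟨y, hy, (h y).symm⟩
  · rintro ⟨y, hy, rfl⟩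
    exact ⟨y, hy, h y⟩

theorem mem_span_sup_span {u v x : Fin 2 → F} :
    x ∈ Submodule.span 𝒪[F] {u} ⊔ Submodule.span 𝒪[F] {v} ↔
      ∃ a d : 𝒪[F], a • u + d • v = x := by
  rw [← Submodule.span_union, Set.singleton_union, Submodule.mem_span_pair]

theorem mem_span_basis {b : Module.Basis (Fin 2) F (Fin 2 → F)} {x : Fin 2 → F} :
    x ∈ Submodule.span 𝒪[F] {b 0} ⊔ Submodule.span 𝒪[F] {b 1} ↔
      b.repr x 0 ∈ 𝒪[F] ∧ b.repr x 1 ∈ 𝒪[F] := by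
  rw [mem_span_sup_span]
  constructor
  · rintro ⟨a, d, rfl⟩
    constructor <;> simp [Subring.smul_def]
  · rintro ⟨h0, h1⟩
    refine ⟨⟨_, h0⟩, ⟨_, h1⟩, ?_⟩
    have := b.sum_repr x
    rwa [Fin.sum_univ_two] at this

theorem uniformizer_not_mul_eq_one {ϖ : 𝒪[F]} (hϖ : Irreducible ϖ) (a : 𝒪[F]) :
    (a : F) * (ϖ : F) ≠ 1 := fun h =>
  hϖ.not_isUnit (IsUnit.of_mul_eq_one_right a (Subtype.ext h))

theorem uniformizer_ne_zero {ϖ : 𝒪[F]} (hϖ : Irreducible ϖ) : (ϖ : F) ≠ 0 :=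
  fun h0 => hϖ.ne_zero (Subtype.ext h0)

omit [ValuativeRel F] in
theorem exists_gl_smul_basis (b b' : Module.Basis (Fin 2) F (Fin 2 → F)) :
    ∃ g : GL (Fin 2) F, ∀ i, g • b i = b' i := by
  refine ⟨Matrix.GeneralLinearGroup.toLin.symm
    (LinearMap.GeneralLinearGroup.ofLinearEquiv (b.equiv b' (Equiv.refl _))), fun i => ?_⟩
  change (LinearMap.toMatrix' (b.equiv b' (Equiv.refl _)).toLinearMap).mulVec (b i) = b' i
  rw [LinearMap.toMatrix'_mulVec]
  simp

theorem smul_span_singleton (g : GL (Fin 2) F) (x : Fin 2 → F) :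
    g • Submodule.span 𝒪[F] {x} = Submodule.span 𝒪[F] {g • x} := by
  rw [← Set.smul_set_singleton]; exact Submodule.map_span _ _

theorem smul_span_sup_span (g : GL (Fin 2) F) (x y : Fin 2 → F) :
    g • (Submodule.span 𝒪[F] {x} ⊔ Submodule.span 𝒪[F] {y}) =
      Submodule.span 𝒪[F] {g • x} ⊔ Submodule.span 𝒪[F] {g • y} := by
  rw [← smul_span_singleton, ← smul_span_singleton]
  exact Submodule.map_sup _ _ _

variable [TopologicalSpace F] [IsNonarchimedeanLocalField F]

/-- An element `a • u + d • v` outside the smaller module has `d` a unit, so together with `u` it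
already generates `v`. -/
theorem span_covBy {ϖ : 𝒪[F]} (hϖ : Irreducible ϖ) {u v : Fin 2 → F}
    (hv : v ∉ Submodule.span 𝒪[F] {u} ⊔ Submodule.span 𝒪[F] {ϖ • v}) :
    Submodule.span 𝒪[F] {u} ⊔ Submodule.span 𝒪[F] {ϖ • v} ⋖
      Submodule.span 𝒪[F] {u} ⊔ Submodule.span 𝒪[F] {v} := by
  have hle : Submodule.span 𝒪[F] {u} ⊔ Submodule.span 𝒪[F] {ϖ • v} ≤
      Submodule.span 𝒪[F] {u} ⊔ Submodule.span 𝒪[F] {v} :=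
    sup_le_sup_left ((Submodule.span_singleton_le_iff_mem _ _).mpr
      (Submodule.smul_mem _ _ (Submodule.mem_span_singleton_self _))) _
  have hvr : v ∈ Submodule.span 𝒪[F] {u} ⊔ Submodule.span 𝒪[F] {v} :=
    Submodule.mem_sup_right (Submodule.mem_span_singleton_self _)
  refine ⟨lt_of_le_of_ne hle fun h => hv (h ▸ hvr), fun N h1 h2 => h2.not_ge ?_⟩
  obtain ⟨x, hxN, hx⟩ := SetLike.exists_of_lt h1
  have huN : u ∈ N := h1.le (Submodule.mem_sup_left (Submodule.mem_span_singleton_self _))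
  obtain ⟨a, d, rfl⟩ := mem_span_sup_span.mp (h2.le hxN)
  have hd : IsUnit d := by
    by_contra hd
    have : d ∈ 𝓂[F] := hd
    rw [hϖ.maximalIdeal_eq, Ideal.mem_span_singleton] at this
    obtain ⟨d', rfl⟩ := this
    exact hx (mem_span_sup_span.mpr ⟨a, d', by rw [smul_smul, mul_comm]⟩)
  have hvN : v ∈ N := by
    have h3 : d • v ∈ N := by
      have := N.sub_mem hxN (N.smul_mem a huN)
      rwa [add_sub_cancel_left] at this
    obtain ⟨d, rfl⟩ := hd
    have := N.smul_mem ((d⁻¹ : 𝒪[F]ˣ) : 𝒪[F]) h3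
    rwa [smul_smul, Units.inv_mul, one_smul] at this
  exact sup_le ((Submodule.span_singleton_le_iff_mem _ _).mpr huN)
    ((Submodule.span_singleton_le_iff_mem _ _).mpr hvN)

theorem LatticeAdj.covBy {L M : Lattice F} (h : LatticeAdj L M) : M.1 ⋖ L.1 := by
  obtain ⟨b, hL, hM⟩ := h
  obtain ⟨ϖ, hϖ⟩ := IsDiscreteValuationRing.exists_irreducible 𝒪[F]
  rw [hL, hM, maximalIdeal_smul_span hϖ]
  refine span_covBy hϖ fun h => ?_
  obtain ⟨a, d, h⟩ := mem_span_sup_span.mp h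
  have := congrArg (fun z => b.repr z 1) h
  simp [Subring.smul_def] at this
  exact uniformizer_not_mul_eq_one hϖ d this

theorem LatticeAdj.maximalIdeal_smul_covBy {L M : Lattice F} (h : LatticeAdj L M) :
    𝓂[F] • L.1 ⋖ M.1 := by
  obtain ⟨b, hL, hM⟩ := h
  obtain ⟨ϖ, hϖ⟩ := IsDiscreteValuationRing.exists_irreducible 𝒪[F]
  rw [hL, hM, Submodule.smul_sup, maximalIdeal_smul_span hϖ, maximalIdeal_smul_span hϖ,
    sup_comm, sup_comm (Submodule.span 𝒪[F] {b 0})]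
  refine span_covBy hϖ fun h => ?_
  obtain ⟨a, d, h⟩ := mem_span_sup_span.mp h
  have := congrArg (fun z => b.repr z 0) h
  simp [Subring.smul_def] at this
  exact uniformizer_not_mul_eq_one hϖ d this

theorem maximalIdeal_smul_eq {ϖ : 𝒪[F]} (hϖ : Irreducible ϖ) (L : Submodule 𝒪[F] (Fin 2 → F)) :
    𝓂[F] • L = Units.mk0 (ϖ : F) (uniformizer_ne_zero hϖ) • L := by
  rw [hϖ.maximalIdeal_eq, Submodule.ideal_span_singleton_smul]
  rfl

theorem equiv_of_eq_maximalIdeal_smul {L M : Lattice F} (h : M.1 = 𝓂[F] • L.1) : L ≈ M := by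
  obtain ⟨ϖ, hϖ⟩ := IsDiscreteValuationRing.exists_irreducible 𝒪[F]
  exact ⟨_, h.trans (maximalIdeal_smul_eq hϖ _)⟩

theorem exists_latticeAdj_of_adj {L : Lattice F} {y : Vertex F}
    (h : (tree F).Adj (Quotient.mk _ L) y) :
    ∃ M : Lattice F, y = Quotient.mk _ M ∧ LatticeAdj L M := by
  obtain ⟨L', M', hL, rfl, h⟩ := h
  obtain ⟨c, hc⟩ : L' ≈ L := Quotient.exact hL.symm
  have h' := h.smul (Matrix.GeneralLinearGroup.scalar (Fin 2) c)
  have e : Matrix.GeneralLinearGroup.scalar (Fin 2) c • L' = L :=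
    Subtype.ext ((scalar_smul_lattice c L'.1).trans hc.symm)
  rw [e] at h'
  exact ⟨_, Quotient.sound ⟨c, scalar_smul_lattice c M'.1⟩, h'⟩

/-- The lattices along a walk without backtracking: modulo `𝔭 L` they all agree with the second
one. -/
theorem exists_lattice_chain {s : ℕ → Vertex F} {L M : Lattice F} (hLM : LatticeAdj L M)
    (h0 : s 0 = Quotient.mk _ L) (h1 : s 1 = Quotient.mk _ M) (n : ℕ)
    (hadj : ∀ i < n + 1, (tree F).Adj (s i) (s (i + 1)))
    (hne : ∀ i < n, s i ≠ s (i + 2)) :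
    ∃ A B : Lattice F, s n = Quotient.mk _ A ∧ s (n + 1) = Quotient.mk _ B ∧ LatticeAdj A B ∧
      A.1 ≤ L.1 ∧ B.1 ⊔ 𝓂[F] • L.1 = M.1 := by
  induction n with
  | zero => exact ⟨L, M, h0, h1, hLM, le_rfl, sup_eq_left.mpr hLM.maximalIdeal_smul_covBy.le⟩
  | succ n ih =>
    obtain ⟨A, B, hA, hB, hAB, hAL, hBM⟩ :=
      ih (fun i hi => hadj i (hi.trans (Nat.lt_succ_self _))) fun i hi => hne i (by omega)
    have h2 := hadj (n + 1) (by omega)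
    rw [hB] at h2
    obtain ⟨C, hC, hBC⟩ := exists_latticeAdj_of_adj h2
    refine ⟨B, C, hB, hC, hBC, hAB.covBy.le.trans hAL, ?_⟩
    -- `C = 𝔭 A` would represent the same vertex as `A`, a backtracking. So `C` and `𝔭 A` are
    -- distinct maximal submodules of `B`, and their sum is `B`.
    have hne' : C.1 ≠ 𝓂[F] • A.1 := fun h => hne n (by omega) <| by
      rw [hA, hC]
      exact Quotient.sound (equiv_of_eq_maximalIdeal_smul h)
    have h3 := hBC.covBy.wcovBy.sup_eq hAB.maximalIdeal_smul_covBy.wcovBy hne'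
    rw [← hBM, ← h3, sup_assoc, sup_eq_right.mpr (smul_mono_right _ hAL)]

/-- The Bruhat–Tits tree has no closed walk without backtracking. -/
theorem tree_ne_of_nonbacktracking (s : ℕ → Vertex F) (n : ℕ)
    (hadj : ∀ i < n + 1, (tree F).Adj (s i) (s (i + 1)))
    (hne : ∀ i < n, s i ≠ s (i + 2)) : s 0 ≠ s (n + 1) := by
  obtain ⟨L, h0⟩ : ∃ L : Lattice F, s 0 = Quotient.mk _ L :=
    ⟨(s 0).out, (Quotient.out_eq _).symm⟩
  have h2 := hadj 0 (by omega)
  rw [h0] at h2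
  obtain ⟨M, h1, hLM⟩ := exists_latticeAdj_of_adj h2
  obtain ⟨A, B, -, hB, hAB, hAL, hBM⟩ := exists_lattice_chain hLM h0 h1 n hadj hne
  rw [h0, hB]
  intro h
  obtain ⟨c, hc⟩ : L ≈ B := Quotient.exact h
  have hBL : B.1 < L.1 := (le_sup_left.trans hBM.le).trans_lt hLM.covBy.lt
  obtain ⟨b, hL, -⟩ := id hLM
  have hmem : c • b 0 ∈ L.1 := hBL.le <| by
    rw [hc, hL]
    exact ⟨b 0, Submodule.mem_sup_left (Submodule.mem_span_singleton_self _), rfl⟩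
  rw [hL, mem_span_basis] at hmem
  have hcO : (c : F) ∈ 𝒪[F] := by simpa [Units.smul_def] using hmem.1
  obtain ⟨c', hc'⟩ : ∃ c' : 𝒪[F], (c' : F) = c := ⟨⟨c, hcO⟩, rfl⟩
  have hsm : ∀ x, c • x = c' • x := fun x : Fin 2 → F => by
    rw [Units.smul_def, Subring.smul_def, hc']
  -- Here `B = c L` with `c` integral. A unit `c` gives `B = L`, against `B < L`; otherwise `B ≤ 𝔭
  -- L`, and `B + 𝔭 L = M` collapses to `𝔭 L = M`.
  by_cases hu : IsUnit c'
  · obtain ⟨d, hd⟩ := hu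
    refine hBL.not_ge fun x hx => ?_
    rw [hc]
    refine ⟨((d⁻¹ : 𝒪[F]ˣ) : 𝒪[F]) • x, L.1.smul_mem _ hx, ?_⟩
    change c • _ = x
    rw [hsm, ← hd, smul_smul, Units.mul_inv, one_smul]
  · have hle : B.1 ≤ 𝓂[F] • L.1 := by
      rw [hc]
      rintro _ ⟨x, hx, rfl⟩
      change c • x ∈ _
      rw [hsm]
      exact Submodule.smul_mem_smul hu hx
    rw [sup_eq_right.mpr hle] at hBM
    exact hLM.maximalIdeal_smul_covBy.lt.ne hBM

/-- Neighbours of `[L]` come from lattices between `𝔭 L` and `L`, and `L / 𝔭 L` is finite. -/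
theorem tree_neighborSet_finite (x : Vertex F) : ((tree F).neighborSet x).Finite := by
  obtain ⟨L, rfl⟩ := Quotient.exists_rep x
  have : Module.Finite 𝒪[F] L.1 := Module.Finite.iff_fg.mpr L.2.fg
  have : Finite (𝒪[F] ⧸ 𝓂[F]) := inferInstanceAs (Finite 𝓀[F])
  have : Subsingleton (L.1 ⧸ (⊤ : Submodule 𝒪[F] L.1)) :=
    Submodule.Quotient.subsingleton_iff.mpr rfl
  have : Finite (L.1 ⧸ 𝓂[F] • (⊤ : Submodule 𝒪[F] L.1)) :=
    Submodule.finite_quotient_smul _ Module.Finite.fg_top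
  have : Finite (Set.Ici (𝓂[F] • (⊤ : Submodule 𝒪[F] L.1))) :=
    Finite.of_equiv _ (Submodule.comapMkQRelIso _).toEquiv
  have hfin : {M : Lattice F | LatticeAdj L M}.Finite := by
    refine Set.Finite.of_finite_image (f := fun M => M.1.comap L.1.subtype)
      ((Set.toFinite (Set.Ici (𝓂[F] • (⊤ : Submodule 𝒪[F] L.1)))).subset ?_) ?_
    · rintro _ ⟨M, hM, rfl⟩
      change 𝓂[F] • (⊤ : Submodule 𝒪[F] L.1) ≤ M.1.comap L.1.subtype
      rw [← Submodule.map_le_iff_le_comap, Submodule.map_smul'', Submodule.map_subtype_top]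
      exact LatticeAdj.maximalIdeal_smul_covBy hM |>.le
    · intro M hM N hN h
      have h' := congrArg (Submodule.map L.1.subtype) h
      simp only [Submodule.map_comap_subtype] at h'
      rw [inf_eq_right.mpr (LatticeAdj.covBy hM).le, inf_eq_right.mpr (LatticeAdj.covBy hN).le] at h'
      exact Subtype.ext h'
  refine (hfin.image (Quotient.mk _)).subset fun y hy => ?_
  obtain ⟨M, rfl, hM⟩ := exists_latticeAdj_of_adj hy
  exact ⟨M, hM, rfl⟩

/-- Exchanging the two basis vectors fixes `L` and carries `𝒪 b₀ ⊕ 𝔭 b₁` to `𝒪 b₁ ⊕ 𝔭 b₀`. A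
homothety between these two would have a ratio `c ∈ 𝔭` with `1 ∈ c 𝔭`. -/
theorem tree_exists_adj_ne {x y : Vertex F} (h : (tree F).Adj x y) :
    ∃ z, (tree F).Adj x z ∧ z ≠ y := by
  obtain ⟨L, M, rfl, rfl, h⟩ := h
  obtain ⟨b, hL, hM⟩ := id h
  obtain ⟨ϖ, hϖ⟩ := IsDiscreteValuationRing.exists_irreducible 𝒪[F]
  obtain ⟨g, hg⟩ := exists_gl_smul_basis b (b.reindex (Equiv.swap 0 1))
  have hg0 : g • b 0 = b 1 := by simpa using hg 0
  have hg1 : g • b 1 = b 0 := by simpa using hg 1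
  have hgL : g • L = L := Subtype.ext <| by
    change g • L.1 = L.1
    rw [hL, smul_span_sup_span, hg0, hg1, sup_comm]
  have hgM : (g • M).1 = Submodule.span 𝒪[F] {b 1} ⊔ Submodule.span 𝒪[F] {ϖ • b 0} := by
    change g • M.1 = _
    rw [hM, maximalIdeal_smul_span hϖ, smul_span_sup_span, smul_comm, hg0, hg1]
  rw [maximalIdeal_smul_span hϖ] at hM
  have h' := h.smul g
  rw [hgL] at h'
  refine ⟨_, ⟨_, _, rfl, rfl, h'⟩, fun heq => ?_⟩
  obtain ⟨c, hc⟩ : g • M ≈ M := Quotient.exact heq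
  have h0 : c • b 1 ∈ M.1 := by
    rw [hc, hgM]
    exact ⟨b 1, Submodule.mem_sup_left (Submodule.mem_span_singleton_self _), rfl⟩
  have h1 : b 0 ∈ c • (g • M).1 := by
    rw [← hc, hM]
    exact Submodule.mem_sup_left (Submodule.mem_span_singleton_self _)
  obtain ⟨x, hx, hx1⟩ := h1
  have hx1 : c • x = b 0 := hx1
  replace hx : x ∈ (g • M).1 := hx
  rw [hM] at h0
  rw [hgM] at hx
  obtain ⟨a, d, h0⟩ := mem_span_sup_span.mp h0
  obtain ⟨a', d', rfl⟩ := mem_span_sup_span.mp hx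
  have e1 : (d : F) * ϖ = c := by
    have := congrArg (fun z => b.repr z 1) h0
    simpa [Units.smul_def, Subring.smul_def] using this
  have e2 : (c : F) * (d' * ϖ) = 1 := by
    have := congrArg (fun z => b.repr z 0) hx1
    simpa [Units.smul_def, Subring.smul_def] using this
  refine uniformizer_not_mul_eq_one hϖ (d * ϖ * d') ?_
  push_cast
  rw [← e2, ← e1]; ring

/-- An edge is given by a basis, and `GL(2, F)` is transitive on bases. -/
theorem tree_exists_smul_eq {e e' : Sym2 (Vertex F)} (he : e ∈ (tree F).edgeSet)
    (he' : e' ∈ (tree F).edgeSet) : ∃ g : PGL(2, F), e.map (g • ·) = e' := by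
  induction e with | _ x y =>
  induction e' with | _ x' y' =>
  obtain ⟨L, M, rfl, rfl, b, hL, hM⟩ := he
  obtain ⟨L', M', rfl, rfl, b', hL', hM'⟩ := he'
  obtain ⟨ϖ, hϖ⟩ := IsDiscreteValuationRing.exists_irreducible 𝒪[F]
  obtain ⟨g, hg⟩ := exists_gl_smul_basis b b'
  have hgL : g • L = L' := Subtype.ext <| by
    change g • L.1 = _
    rw [hL, hL', smul_span_sup_span, hg, hg]
  have hgM : g • M = M' := Subtype.ext <| by
    change g • M.1 = _
    rw [hM, hM', maximalIdeal_smul_span hϖ, maximalIdeal_smul_span hϖ, smul_span_sup_span,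
      smul_comm g, hg, hg]
  refine ⟨Matrix.ProjGenLinGroup.mk g, ?_⟩
  change s(Quotient.mk _ (g • L), Quotient.mk _ (g • M)) = _
  rw [hgL, hgM]
  rfl

theorem isOpen_span_basis (b : Module.Basis (Fin 2) F (Fin 2 → F)) :
    IsOpen ((Submodule.span 𝒪[F] {b 0} ⊔ Submodule.span 𝒪[F] {b 1} : Submodule 𝒪[F] (Fin 2 → F)) :
      Set (Fin 2 → F)) := by
  have h : ∀ i, IsOpen {x : Fin 2 → F | b.repr x i ∈ 𝒪[F]} := fun i =>
    (Valuation.isOpen_integer (v := ValuativeRel.valuation F)).preimage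
      (LinearMap.continuous_on_pi (b.coord i))
  convert! (h 0).inter (h 1) using 1
  ext x
  exact mem_span_basis

/-- The adjacency provides a basis of a lattice `L` representing `x`. As `L` is open, the `g` for
which `g` and `g⁻¹` send this basis into `L` form a neighbourhood of `1`, and they all preserve `L`.
-/
theorem tree_isOpen_stabilizer {x y : Vertex F} (h : (tree F).Adj x y) :
    IsOpen (MulAction.stabilizer PGL(2, F) x : Set PGL(2, F)) := by
  obtain ⟨L, M, rfl, rfl, b, hL, hM⟩ := h
  have hq : Topology.IsQuotientMap (Matrix.ProjGenLinGroup.mk : GL (Fin 2) F → PGL(2, F)) :=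
    isQuotientMap_quotient_mk'
  rw [← hq.isOpen_preimage]
  let S : Subgroup (GL (Fin 2) F) := (MulAction.stabilizer PGL(2, F)
    (show Vertex F from Quotient.mk _ L)).comap Matrix.ProjGenLinGroup.mk
  change IsOpen (S : Set (GL (Fin 2) F))
  have hcont : ∀ x : Fin 2 → F, Continuous fun g : GL (Fin 2) F => g • x := fun x =>
    Continuous.matrix_mulVec Units.continuous_val continuous_const
  have hopen : ∀ i, IsOpen {g : GL (Fin 2) F | g • b i ∈ L.1 ∧ g⁻¹ • b i ∈ L.1} := fun i => by
    have hLo : IsOpen (L.1 : Set (Fin 2 → F)) := by rw [hL]; exact isOpen_span_basis b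
    exact (hLo.preimage (hcont (b i))).inter (hLo.preimage ((hcont (b i)).comp continuous_inv))
  have hmem : ∀ i, b i ∈ L.1 := fun i => by
    rw [hL]
    fin_cases i
    · exact Submodule.mem_sup_left (Submodule.mem_span_singleton_self _)
    · exact Submodule.mem_sup_right (Submodule.mem_span_singleton_self _)
  have hle : ∀ g : GL (Fin 2) F, (∀ i, g • b i ∈ L.1) → g • L.1 ≤ L.1 := fun g hg => by
    conv_lhs => rw [hL, smul_span_sup_span]
    exact sup_le ((Submodule.span_singleton_le_iff_mem _ _).mpr (hg 0))
      ((Submodule.span_singleton_le_iff_mem _ _).mpr (hg 1))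
  refine S.isOpen_of_mem_nhds (g := 1) (Filter.mem_of_superset
    (((hopen 0).inter (hopen 1)).mem_nhds ⟨?_, ?_⟩) fun g hg => ?_)
  · exact ⟨by rw [one_smul]; exact hmem 0, by rw [inv_one, one_smul]; exact hmem 0⟩
  · exact ⟨by rw [one_smul]; exact hmem 1, by rw [inv_one, one_smul]; exact hmem 1⟩
  · have h1 := hle g fun i => by fin_cases i; exacts [hg.1.1, hg.2.1]
    have h2 := hle g⁻¹ fun i => by fin_cases i; exacts [hg.1.2, hg.2.2]
    refine congrArg (Quotient.mk _) (Subtype.ext (le_antisymm h1 fun x hx => ?_) : g • L = L)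
    exact ⟨g⁻¹ • x, h2 ⟨x, hx, rfl⟩, smul_inv_smul g x⟩

end TreeGeometry

/-! ### Cochains and functoriality of cohomology -/

section Cochains

variable {V V' : Type*} {Γ : SimpleGraph V} {Γ' : SimpleGraph V'}

open Classical in
/-- The value of a function on oriented edges at a pair of vertices, zero if they are not
adjacent. -/
def dartEval (Γ : SimpleGraph V) (a b : V) : (Γ.Dart → ℂ) →ₗ[ℂ] ℂ :=
  if h : Γ.Adj a b then LinearMap.proj ⟨(a, b), h⟩ else 0

theorem dartEval_of_adj {a b : V} (h : Γ.Adj a b) (ω : Γ.Dart → ℂ) :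
    dartEval Γ a b ω = ω ⟨(a, b), h⟩ := by
  simp [dartEval, h]

theorem adj_of_dartEval_ne_zero {a b : V} {ω : Γ.Dart → ℂ} (h : dartEval Γ a b ω ≠ 0) :
    Γ.Adj a b := by
  by_contra h'
  simp [dartEval, h'] at h

theorem dartEval_coboundary {a b : V} (h : Γ.Adj a b) (f : V → ℂ) :
    dartEval Γ a b (coboundary Γ f) = f b - f a := by
  rw [dartEval_of_adj h]; rfl

theorem dartEval_funRep {H : Type*} [Group H] [MulAction H V] [GraphAction H Γ] (h : H) (a b : V)
    (ω : Γ.Dart → ℂ) :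
    dartEval Γ a b (funRep H Γ.Dart h ω) = dartEval Γ (h⁻¹ • a) (h⁻¹ • b) ω := by
  by_cases hab : Γ.Adj a b
  · rw [dartEval_of_adj hab, dartEval_of_adj (GraphAction.adj_smul _ _ _ hab)]
    rfl
  · have h' : ¬ Γ.Adj (h⁻¹ • a) (h⁻¹ • b) := fun h' => hab <| by
      simpa only [smul_inv_smul] using GraphAction.adj_smul h _ _ h'
    simp [dartEval, hab, h']

theorem finite_dartEval_ne_zero {ω : Γ.Dart → ℂ} (hω : ω.support.Finite) :
    {p : V × V | dartEval Γ p.1 p.2 ω ≠ 0}.Finite := by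
  refine (hω.image SimpleGraph.Dart.toProd).subset fun p hp => ?_
  have hadj := adj_of_dartEval_ne_zero hp
  refine ⟨⟨p, hadj⟩, ?_, rfl⟩
  rwa [Set.mem_ofPred_eq, dartEval_of_adj hadj] at hp

theorem H1c_mk_eq_iff {ω ω' : cochain1 Γ} :
    (Submodule.Quotient.mk ω : H1c Γ) = Submodule.Quotient.mk ω' ↔
      ∃ f ∈ cochain0 V, coboundary Γ f = ω.1 - ω'.1 := by
  rw [Submodule.Quotient.eq]
  rfl

theorem H1c_mk_eq_zero_iff {ω : cochain1 Γ} :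
    (Submodule.Quotient.mk ω : H1c Γ) = 0 ↔ ∃ f ∈ cochain0 V, coboundary Γ f = ω.1 := by
  rw [Submodule.Quotient.mk_eq_zero]
  rfl

/-- Pull-back of finitely supported `1`-cochains along a graph morphism with finite fibres. -/
def cochain1Pull (φ : Γ →g Γ') (hφ : ∀ v', (φ ⁻¹' {v'}).Finite) : cochain1 Γ' →ₗ[ℂ] cochain1 Γ :=
  (LinearMap.funLeft ℂ ℂ φ.mapDart).restrict fun ω hω => by
    refine ⟨?_, fun a => hω.2 (φ.mapDart a)⟩
    have hfin : (φ.mapDart ⁻¹' ω.support).Finite := by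
      refine hω.1.preimage' fun d _ => ?_
      refine Set.Finite.of_finite_image (f := SimpleGraph.Dart.toProd)
        (((hφ d.fst).prod (hφ d.snd)).subset ?_) SimpleGraph.Dart.toProd_injective.injOn
      rintro _ ⟨a, rfl, rfl⟩
      exact ⟨rfl, rfl⟩
    exact hfin

theorem dartEval_cochain1Pull (φ : Γ →g Γ') (hφ : ∀ v', (φ ⁻¹' {v'}).Finite) (ω : cochain1 Γ')
    {a b : V} (h : Γ.Adj a b) :
    dartEval Γ a b (cochain1Pull φ hφ ω).1 = dartEval Γ' (φ a) (φ b) ω.1 := by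
  rw [dartEval_of_adj h, dartEval_of_adj (φ.map_adj h)]
  rfl

/-- Functoriality of `H¹_c` for graph morphisms with finite fibres. -/
def H1cPull (φ : Γ →g Γ') (hφ : ∀ v', (φ ⁻¹' {v'}).Finite) : H1c Γ' →ₗ[ℂ] H1c Γ :=
  Submodule.mapQ _ _ (cochain1Pull φ hφ) <| by
    rintro ω ⟨f, hf, hfω⟩
    have hf' : f.support.Finite := hf
    refine ⟨f ∘ φ, hf'.preimage' fun v _ => hφ v, ?_⟩
    funext a
    exact congrFun hfω (φ.mapDart a)

theorem H1cPull_equivariant {H H' : Type*} [Group H] [Group H'] [MulAction H V] [GraphAction H Γ]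
    [MulAction H' V'] [GraphAction H' Γ'] (j : H →* H') (φ : Γ →g Γ')
    (hφ : ∀ v', (φ ⁻¹' {v'}).Finite) (hj : ∀ h v, φ (h • v) = j h • φ v) (h : H) (z : H1c Γ') :
    H1cPull φ hφ (H1cRep H' Γ' (j h) z) = H1cRep H Γ h (H1cPull φ hφ z) := by
  obtain ⟨ω, rfl⟩ := Submodule.Quotient.mk_surjective _ z
  refine congrArg (Submodule.Quotient.mk) (Subtype.ext (funext fun a => ?_))
  refine congrArg ω.1 (SimpleGraph.Dart.ext _ _ (Prod.ext ?_ ?_))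
  · change (j h)⁻¹ • φ a.fst = φ (h⁻¹ • a.fst)
    rw [hj, map_inv]
  · change (j h)⁻¹ • φ a.snd = φ (h⁻¹ • a.snd)
    rw [hj, map_inv]

/-- Extension by zero is a preimage; it stays antisymmetric because the image of the oriented edges
is stable under reversal. -/
theorem cochain1Pull_surjective (φ : Γ →g Γ') (hφ : ∀ v', (φ ⁻¹' {v'}).Finite)
    (hinj : Function.Injective φ) : Function.Surjective (cochain1Pull φ hφ) := by
  intro κ
  have hinj' : Function.Injective φ.mapDart := fun a b h =>
    SimpleGraph.Dart.ext _ _ (Prod.ext (hinj (congrArg (·.fst) h)) (hinj (congrArg (·.snd) h)))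
  refine ⟨⟨Function.extend φ.mapDart κ.1 0, ?_, fun a => ?_⟩, ?_⟩
  · refine (κ.2.1.image φ.mapDart).subset fun a ha => ?_
    by_cases h : ∃ b, φ.mapDart b = a
    · obtain ⟨b, rfl⟩ := h
      rw [Function.mem_support, hinj'.extend_apply] at ha
      exact ⟨b, ha, rfl⟩
    · exact absurd (Function.extend_apply' _ _ _ h) ha
  · by_cases h : ∃ b, φ.mapDart b = a
    · obtain ⟨b, rfl⟩ := h
      rw [hinj'.extend_apply, show (φ.mapDart b).symm = φ.mapDart b.symm from rfl,
        hinj'.extend_apply]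
      exact κ.2.2 b
    · have h' : ¬ ∃ b, φ.mapDart b = a.symm := fun ⟨b, hb⟩ =>
        h ⟨b.symm, (congrArg SimpleGraph.Dart.symm hb).trans a.symm_symm⟩
      rw [Function.extend_apply' _ _ _ h, Function.extend_apply' _ _ _ h']
      simp
  · exact Subtype.ext (funext fun a => hinj'.extend_apply _ _ a)

end Cochains

/-! ### Paths in a leafless tree and the edges of the tower -/

section Towers

variable {V : Type*} {X : SimpleGraph V}

theorem tower_adj_tail_head {n : ℕ} (x : OrientedPath X (n + 1)) : (tower X n).Adj x.tail x.head :=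
  ⟨x, Or.inl ⟨rfl, rfl⟩⟩

theorem tower_cochain_ext {n : ℕ} {ω ω' : (tower X n).Dart → ℂ}
    (hω : ∀ a, ω a = - ω a.symm) (hω' : ∀ a, ω' a = - ω' a.symm)
    (h : ∀ x : OrientedPath X (n + 1),
      dartEval (tower X n) x.tail x.head ω = dartEval (tower X n) x.tail x.head ω') :
    ω = ω' := by
  have key : ∀ (x : OrientedPath X (n + 1)) (a : (tower X n).Dart), x.tail = a.fst →
      x.head = a.snd → ω a = ω' a := fun x a h1 h2 => by
    have := h x
    rw [dartEval_of_adj (tower_adj_tail_head x), dartEval_of_adj (tower_adj_tail_head x)] at this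
    have e : a = ⟨(x.tail, x.head), tower_adj_tail_head x⟩ :=
      SimpleGraph.Dart.ext _ _ (Prod.ext h1.symm h2.symm)
    rw [e, this]
  funext a
  obtain ⟨x, ⟨h1, h2⟩ | ⟨h1, h2⟩⟩ := a.adj
  · exact key x a h1 h2
  · rw [hω, hω', key x a.symm h1 h2]

/-- For `n ≥ 1` distinct paths give distinct oriented edges, none the reverse of another, so values
on the positively oriented edges can be prescribed freely and then antisymmetrized. -/
theorem exists_tower_cochain {n : ℕ} (hn : 1 ≤ n) {w : OrientedPath X (n + 1) → ℂ}
    (hw : w.support.Finite) : ∃ ω : cochain1 (tower X n), ∀ x : OrientedPath X (n + 1),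
      dartEval (tower X n) x.tail x.head ω.1 = w x := by
  let ι : OrientedPath X (n + 1) → (tower X n).Dart := fun x =>
    ⟨(x.tail, x.head), tower_adj_tail_head x⟩
  have hι : Function.Injective ι := fun x y h =>
    tower_edge_unique X hn x y (Or.inl ⟨congrArg (·.fst) h, congrArg (·.snd) h⟩)
  have hι' : ∀ x, ¬ ∃ y, ι y = (ι x).symm := fun x ⟨y, h⟩ => by
    have h1 : y.tail = x.head := congrArg (·.fst) h
    have h2 : y.head = x.tail := congrArg (·.snd) h
    have := tower_edge_unique X hn y x (Or.inr ⟨h1, h2⟩)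
    subst this
    exact (tower_adj_tail_head y).ne h1
  have hfin : (Function.extend ι w 0).support.Finite := by
    refine (hw.image ι).subset fun a ha => ?_
    by_cases h : ∃ b, ι b = a
    · obtain ⟨b, rfl⟩ := h
      rw [Function.mem_support, hι.extend_apply] at ha
      exact ⟨b, ha, rfl⟩
    · exact absurd (Function.extend_apply' _ _ _ h) ha
  refine ⟨⟨fun a => Function.extend ι w 0 a - Function.extend ι w 0 a.symm, ?_, fun a => ?_⟩,
    fun x => ?_⟩
  · refine (hfin.union (hfin.preimage SimpleGraph.Dart.symm_involutive.injective.injOn)).subset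
      fun a ha => ?_
    by_contra h
    simp only [Set.mem_union, Set.mem_preimage, Function.mem_support, not_or, not_not] at h
    simp [h.1, h.2] at ha
  · simp
  · rw [dartEval_of_adj (tower_adj_tail_head x)]
    change Function.extend ι w 0 (ι x) - Function.extend ι w 0 (ι x).symm = w x
    rw [hι.extend_apply, Function.extend_apply' _ _ _ (hι' x)]
    simp

/-- Locally finite graphs without leaves in which the end points of a walk without backtracking
are distinct. -/
structure LeaflessTree (X : SimpleGraph V) : Prop where
  finite_neighborSet : ∀ x, (X.neighborSet x).Finite
  exists_adj_ne : ∀ {x y}, X.Adj x y → ∃ z, X.Adj x z ∧ z ≠ y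
  ne_of_nonbacktracking : ∀ (s : ℕ → V) (n : ℕ), (∀ i < n + 1, X.Adj (s i) (s (i + 1))) →
    (∀ i < n, s i ≠ s (i + 2)) → s 0 ≠ s (n + 1)

namespace LeaflessTree

variable (hX : LeaflessTree X)
include hX

/-- If `z` already occurred on `c`, going from `z` along `c` up to that occurrence would be a closed
walk without backtracking. -/
theorem exists_cons {n : ℕ} (c : OrientedPath X (n + 1)) {z : V} (hz : X.Adj z (c.vert 0))
    (hz' : z ≠ c.vert 1) : ∃ a : OrientedPath X (n + 2), a.head = c ∧ a.vert 0 = z := by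
  have hnot : z ∉ Set.range c.vert := by
    rintro ⟨i, hi⟩
    -- The walk starts at `z`; the `min` only makes it total, its values past the end of `c` are
    -- never used.
    let s : ℕ → V := fun j => Nat.casesOn j z fun j => c.vert ⟨min j (n + 1), by omega⟩
    have hs : ∀ (j : ℕ) (hj : j < n + 2), s (j + 1) = c.vert ⟨j, hj⟩ := fun j hj =>
      congrArg c.vert (Fin.ext (min_eq_left (by omega)))
    refine hX.ne_of_nonbacktracking s i.1 (fun j hj => ?_) (fun j hj => ?_) ?_
    · cases j with
      | zero => rw [hs 0 (by omega)]; exact hz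
      | succ j =>
        rw [hs j (by omega), hs (j + 1) (by omega)]
        exact c.adj ⟨j, by omega⟩
    · cases j with
      | zero => rw [hs 1 (by omega)]; exact hz'
      | succ j =>
        rw [hs j (by omega), hs (j + 2) (by omega)]
        exact fun h => by simpa using c.injective h
    · rw [hs i.1 i.2]; exact hi.symm
  refine ⟨⟨Fin.cons z c.vert, Fin.cons_injective_iff.mpr ⟨hnot, c.injective⟩, fun i => ?_⟩,
    OrientedPath.ext (funext fun i => rfl), rfl⟩
  refine Fin.cases ?_ (fun i => ?_) i
  · exact hz
  · exact c.adj i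

theorem exists_snoc {n : ℕ} (c : OrientedPath X (n + 1)) {z : V}
    (hz : X.Adj (c.vert (Fin.last _)) z) (hz' : z ≠ c.vert ⟨n, by omega⟩) :
    ∃ a : OrientedPath X (n + 2), a.tail = c ∧ a.vert (Fin.last _) = z := by
  have hnot : z ∉ Set.range c.vert := by
    rintro ⟨i, hi⟩
    -- The same closed walk, with `c` read backwards from its last vertex.
    let s : ℕ → V := fun j => Nat.casesOn j z fun j => c.vert ⟨n + 1 - j, by omega⟩
    have hs : ∀ (j : ℕ), s (j + 1) = c.vert ⟨n + 1 - j, by omega⟩ := fun j => rfl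
    refine hX.ne_of_nonbacktracking s (n + 1 - i.1) (fun j hj => ?_) (fun j hj => ?_) ?_
    · cases j with
      | zero => exact hz.symm
      | succ j =>
        rw [hs j, hs (j + 1)]
        have e : (⟨n + 1 - j, by omega⟩ : Fin (n + 2)) =
          Fin.succ ⟨n + 1 - (j + 1), by omega⟩ := Fin.ext (by simp; omega)
        rw [e]
        exact (c.adj ⟨n + 1 - (j + 1), by omega⟩).symm
    · cases j with
      | zero => exact hz'
      | succ j =>
        rw [hs j, hs (j + 2)]
        intro h
        have := c.injective h
        simp only [Fin.mk.injEq] at this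
        omega
    · rw [hs]
      refine hi.symm.trans (congrArg c.vert (Fin.ext ?_))
      change i.1 = n + 1 - (n + 1 - i.1)
      omega
  refine ⟨⟨Fin.snoc c.vert z, Fin.snoc_injective_iff.mpr ⟨c.injective, hnot⟩, fun i => ?_⟩,
    OrientedPath.ext (funext fun i => ?_), ?_⟩
  · refine Fin.lastCases ?_ (fun i => ?_) i
    · rw [Fin.succ_last, Fin.snoc_last, Fin.snoc_castSucc]
      exact hz
    · rw [Fin.succ_castSucc, Fin.snoc_castSucc, Fin.snoc_castSucc]
      exact c.adj i
  · exact Fin.snoc_castSucc (α := fun _ => V) _ _ _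
  · exact Fin.snoc_last (α := fun _ => V) _ _

theorem exists_head_eq {n : ℕ} (c : OrientedPath X (n + 1)) :
    ∃ a : OrientedPath X (n + 2), a.head = c := by
  obtain ⟨z, hz, hz'⟩ := hX.exists_adj_ne (c.adj 0)
  obtain ⟨a, ha, -⟩ := hX.exists_cons c hz.symm hz'
  exact ⟨a, ha⟩

theorem exists_tail_eq {n : ℕ} (c : OrientedPath X (n + 1)) :
    ∃ a : OrientedPath X (n + 2), a.tail = c := by
  obtain ⟨z, hz, hz'⟩ := hX.exists_adj_ne (c.adj (Fin.last n)).symm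
  obtain ⟨a, ha, -⟩ := hX.exists_snoc c (by simpa using hz) hz'
  exact ⟨a, ha⟩

/-- The overlap contains at least one edge, so the second vertex of `b` is the third of `a`, hence
not its first: the union of the two paths does not backtrack. -/
theorem exists_join {n : ℕ} {a b : OrientedPath X (n + 2)} (h : a.head = b.tail) :
    ∃ x : OrientedPath X (n + 3), x.tail = a ∧ x.head = b := by
  have hv : ∀ i : Fin (n + 2), a.vert i.succ = b.vert i.castSucc := fun i =>
    congrFun (congrArg OrientedPath.vert h) i
  obtain ⟨x, rfl, hx⟩ := hX.exists_cons b (z := a.vert 0) (by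
    have := hv 0
    rw [show b.vert 0 = a.vert 1 from this.symm]
    exact a.adj 0) (by
    have := hv 1
    rw [show b.vert 1 = a.vert (Fin.succ 1) from this.symm]
    exact fun h => Fin.succ_ne_zero _ (a.injective h).symm)
  refine ⟨x, OrientedPath.ext (funext fun i => ?_), rfl⟩
  refine Fin.cases hx (fun i => ?_) i
  exact (hv i).symm

theorem tower_adj {n : ℕ} {a b : OrientedPath X (n + 2)} (h : a.head = b.tail) :
    (tower X (n + 2)).Adj a b := by
  obtain ⟨x, rfl, rfl⟩ := hX.exists_join h
  exact tower_adj_tail_head x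

theorem finite_head_preimage {n : ℕ} (c : OrientedPath X n) :
    (OrientedPath.head ⁻¹' {c}).Finite := by
  refine Set.Finite.of_finite_image (f := fun a => a.vert 0)
    ((hX.finite_neighborSet (c.vert 0)).subset ?_) ?_
  · rintro _ ⟨a, rfl, rfl⟩
    exact (a.adj 0).symm
  · intro a ha b hb h
    refine OrientedPath.ext (funext fun i => Fin.cases h (fun i => ?_) i)
    exact congrFun (congrArg OrientedPath.vert (ha.trans hb.symm)) i

theorem finite_tail_preimage {n : ℕ} (c : OrientedPath X n) :
    (OrientedPath.tail ⁻¹' {c}).Finite := by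
  refine Set.Finite.of_finite_image (f := fun a => a.vert (Fin.last _))
    ((hX.finite_neighborSet (c.vert (Fin.last _))).subset ?_) ?_
  · rintro _ ⟨a, rfl, rfl⟩
    exact (a.adj (Fin.last _))
  · intro a ha b hb h
    refine OrientedPath.ext (funext fun i => Fin.lastCases h (fun i => ?_) i)
    exact congrFun (congrArg OrientedPath.vert (ha.trans hb.symm)) i

end LeaflessTree

end Towers

/-! ### Matrices with vanishing row and column sums -/

section Matrices

variable {A B : Type*} {I : Finset A} {O : Finset B}

/-- A matrix with vanishing row and column sums which is a difference `u b - v a` is zero. -/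
theorem eq_zero_of_sums_eq_zero_of_eq_sub (hI : I.Nonempty) (hO : O.Nonempty) {η : A → B → ℂ}
    (hrow : ∀ a ∈ I, ∑ b ∈ O, η a b = 0) (hcol : ∀ b ∈ O, ∑ a ∈ I, η a b = 0)
    {u : B → ℂ} {v : A → ℂ} (h : ∀ a ∈ I, ∀ b ∈ O, η a b = u b - v a) :
    ∀ a ∈ I, ∀ b ∈ O, η a b = 0 := by
  have hI' : (I.card : ℂ) ≠ 0 := by simpa using hI.ne_empty
  have hO' : (O.card : ℂ) ≠ 0 := by simpa using hO.ne_empty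
  -- Zero column sums make `u` constant, equal to the mean of `v`; each row of `u b - v a` is then
  -- constant, hence zero by its sum.
  have hu : ∀ b ∈ O, u b = (∑ a ∈ I, v a) / I.card := fun b hb => by
    have := hcol b hb
    rw [Finset.sum_congr rfl fun a ha => h a ha b hb, Finset.sum_sub_distrib, Finset.sum_const,
      nsmul_eq_mul] at this
    rw [eq_div_iff hI', mul_comm]
    exact sub_eq_zero.mp this
  intro a ha b hb
  have := hrow a ha
  rw [Finset.sum_congr rfl fun b hb => (h a ha b hb).trans (by rw [hu b hb]), Finset.sum_const,
    nsmul_eq_mul] at this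
  rw [h a ha b hb, hu b hb]
  exact (mul_eq_zero.mp this).resolve_left hO'

/-- The subtracted term, column mean minus grand mean plus row mean, is the projection of `W` to the
matrices of the form `u b - v a`. -/
theorem row_sum_sub_averages (hI : I.Nonempty) (hO : O.Nonempty) (W : A → B → ℂ) (a : A) :
    ∑ b ∈ O, (W a b - ((∑ a ∈ I, W a b) / I.card -
      (∑ b ∈ O, ∑ a ∈ I, W a b) / (I.card * O.card) + (∑ b ∈ O, W a b) / O.card)) = 0 := by
  have hI' : (I.card : ℂ) ≠ 0 := by simpa using hI.ne_empty
  have hO' : (O.card : ℂ) ≠ 0 := by simpa using hO.ne_empty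
  rw [Finset.sum_sub_distrib, Finset.sum_add_distrib, Finset.sum_sub_distrib, ← Finset.sum_div,
    Finset.sum_const, Finset.sum_const, nsmul_eq_mul, nsmul_eq_mul]
  field_simp
  ring

theorem column_sum_sub_averages (hI : I.Nonempty) (hO : O.Nonempty) (W : A → B → ℂ) (b : B) :
    ∑ a ∈ I, (W a b - ((∑ a ∈ I, W a b) / I.card -
      (∑ b ∈ O, ∑ a ∈ I, W a b) / (I.card * O.card) + (∑ b ∈ O, W a b) / O.card)) = 0 := by
  have hI' : (I.card : ℂ) ≠ 0 := by simpa using hI.ne_empty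
  have hO' : (O.card : ℂ) ≠ 0 := by simpa using hO.ne_empty
  rw [Finset.sum_sub_distrib, Finset.sum_add_distrib, ← Finset.sum_div,
    Finset.sum_const, nsmul_eq_mul, Finset.sum_comm (s := I)]
  field_simp
  ring

end Matrices

/-! ### Harmonic cochains and the splitting of cohomology -/

section Harmonic

variable {V : Type*} {X : SimpleGraph V} (hX : LeaflessTree X)

/-- The extensions of a path by one step backwards. -/
def LeaflessTree.ins {n : ℕ} (c : OrientedPath X n) : Finset (OrientedPath X (n + 1)) :=
  (hX.finite_head_preimage c).toFinset

/-- The extensions of a path by one step forwards. -/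
def LeaflessTree.outs {n : ℕ} (c : OrientedPath X n) : Finset (OrientedPath X (n + 1)) :=
  (hX.finite_tail_preimage c).toFinset

theorem LeaflessTree.mem_ins {n : ℕ} {c : OrientedPath X n} {a : OrientedPath X (n + 1)} :
    a ∈ hX.ins c ↔ a.head = c := by
  simp [LeaflessTree.ins]

theorem LeaflessTree.mem_outs {n : ℕ} {c : OrientedPath X n} {a : OrientedPath X (n + 1)} :
    a ∈ hX.outs c ↔ a.tail = c := by
  simp [LeaflessTree.outs]

theorem LeaflessTree.ins_nonempty {n : ℕ} (c : OrientedPath X (n + 1)) : (hX.ins c).Nonempty := by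
  obtain ⟨a, ha⟩ := hX.exists_head_eq c
  exact ⟨a, hX.mem_ins.mpr ha⟩

theorem LeaflessTree.outs_nonempty {n : ℕ} (c : OrientedPath X (n + 1)) :
    (hX.outs c).Nonempty := by
  obtain ⟨a, ha⟩ := hX.exists_tail_eq c
  exact ⟨a, hX.mem_outs.mpr ha⟩

/-- The finitely supported `1`-cochains of `X̃_{n+1}` which are orthogonal to all functions of the
head and to all functions of the tail. -/
def harmonic (n : ℕ) : Submodule ℂ (cochain1 (tower X (n + 1))) where
  carrier := {ω | (∀ a, ∑ b ∈ hX.outs a.head, dartEval (tower X (n + 1)) a b ω.1 = 0) ∧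
    ∀ b, ∑ a ∈ hX.ins b.tail, dartEval (tower X (n + 1)) a b ω.1 = 0}
  zero_mem' := by simp
  add_mem' := by
    rintro ω ω' ⟨h1, h2⟩ ⟨h1', h2'⟩
    constructor <;> intro a <;>
      simp only [Submodule.coe_add, map_add, Finset.sum_add_distrib, h1, h2, h1', h2', add_zero]
  smul_mem' := by
    rintro c ω ⟨h1, h2⟩
    constructor <;> intro a <;>
      simp only [Submodule.coe_smul, map_smul, ← Finset.smul_sum, h1, h2, smul_zero]

section Action

variable {H : Type*} [Group H] [MulAction H V] [GraphAction H X]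

theorem OrientedPath.smul_tail {n : ℕ} (h : H) (a : OrientedPath X (n + 1)) :
    (h • a).tail = h • a.tail := rfl

theorem OrientedPath.smul_head {n : ℕ} (h : H) (a : OrientedPath X (n + 1)) :
    (h • a).head = h • a.head := rfl

theorem cochain1Rep_mem_harmonic {n : ℕ} (h : H) {ω : cochain1 (tower X (n + 1))}
    (hω : ω ∈ harmonic hX n) : cochain1Rep H (tower X (n + 1)) h ω ∈ harmonic hX n := by
  constructor
  · intro a
    rw [← hω.1 (h⁻¹ • a)]
    refine Finset.sum_equiv (MulAction.toPerm h⁻¹) (fun b => ?_) fun b _ => dartEval_funRep h a b _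
    rw [hX.mem_outs, hX.mem_outs, MulAction.toPerm_apply, OrientedPath.smul_tail,
      OrientedPath.smul_head]
    exact (MulAction.injective h⁻¹).eq_iff.symm
  · intro b
    rw [← hω.2 (h⁻¹ • b)]
    refine Finset.sum_equiv (MulAction.toPerm h⁻¹) (fun a => ?_) fun a _ => dartEval_funRep h a b _
    rw [hX.mem_ins, hX.mem_ins, MulAction.toPerm_apply, OrientedPath.smul_tail,
      OrientedPath.smul_head]
    exact (MulAction.injective h⁻¹).eq_iff.symm

variable (H) in
/-- The representation on harmonic cochains. -/
def harmonicRep (n : ℕ) : Representation ℂ H (harmonic hX n) :=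
  (cochain1Rep H (tower X (n + 1))).subrepresentation (harmonic hX n) fun h _ hω =>
    cochain1Rep_mem_harmonic hX h hω

end Action

variable {n : ℕ}

theorem tower_cochain_ext_pairs {ω ω' : (tower X (n + 1 + 1)).Dart → ℂ}
    (hω : ∀ a, ω a = - ω a.symm) (hω' : ∀ a, ω' a = - ω' a.symm)
    (h : ∀ a b : OrientedPath X (n + 1 + 1), a.head = b.tail →
      dartEval (tower X (n + 1 + 1)) a b ω = dartEval (tower X (n + 1 + 1)) a b ω') :
    ω = ω' :=
  tower_cochain_ext hω hω' fun _ => h _ _ rfl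

/-- A harmonic cochain vanishes on each complete bipartite piece of `X̃_{n+1}` on which it is a
coboundary. -/
theorem harmonic_eq_zero {η : cochain1 (tower X (n + 1 + 1))} (hη : η ∈ harmonic hX (n + 1))
    {u v : OrientedPath X (n + 1 + 1) → ℂ} (c : OrientedPath X (n + 1))
    (h : ∀ a b, a.head = c → b.tail = c → dartEval (tower X (n + 1 + 1)) a b η.1 = u b - v a)
    {a b : OrientedPath X (n + 1 + 1)} (ha : a.head = c) (hb : b.tail = c) :
    dartEval (tower X (n + 1 + 1)) a b η.1 = 0 := by
  refine eq_zero_of_sums_eq_zero_of_eq_sub (hX.ins_nonempty c) (hX.outs_nonempty c)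
    (η := fun a b => dartEval (tower X (n + 1 + 1)) a b η.1) (u := u) (v := v)
    (fun a ha => ?_) (fun b hb => ?_) (fun a ha b hb => ?_)
    a (hX.mem_ins.mpr ha) b (hX.mem_outs.mpr hb)
  · have := hη.1 a
    rwa [hX.mem_ins.mp ha] at this
  · have := hη.2 b
    rwa [hX.mem_outs.mp hb] at this
  · exact h a b (hX.mem_ins.mp ha) (hX.mem_outs.mp hb)

/-- Averaging is done block by block. A path `b` is a target only in the block of `b.tail`, and `a`
a source only in that of `a.head`, so the `u` and `v` of all blocks assemble into global functions.
-/
theorem exists_harmonic_decomposition (ω : cochain1 (tower X (n + 1 + 1))) :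
    ∃ η ∈ harmonic hX (n + 1), ∃ u ∈ cochain0 (OrientedPath X (n + 1 + 1)),
      ∃ v ∈ cochain0 (OrientedPath X (n + 1 + 1)), ∀ a b, a.head = b.tail →
        dartEval (tower X (n + 1 + 1)) a b ω.1 =
          dartEval (tower X (n + 1 + 1)) a b η.1 + (u b - v a) := by
  let W : OrientedPath X (n + 1 + 1) → OrientedPath X (n + 1 + 1) → ℂ :=
    fun a b => dartEval (tower X (n + 1 + 1)) a b ω.1
  let T : OrientedPath X (n + 1) → ℂ := fun c =>
    (∑ b ∈ hX.outs c, ∑ a ∈ hX.ins c, W a b) / ((hX.ins c).card * (hX.outs c).card)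
  -- Column mean minus the grand mean `T`; the row mean goes into `v` with opposite sign.
  let u : OrientedPath X (n + 1 + 1) → ℂ := fun b =>
    (∑ a ∈ hX.ins b.tail, W a b) / (hX.ins b.tail).card - T b.tail
  let v : OrientedPath X (n + 1 + 1) → ℂ := fun a =>
    -((∑ b ∈ hX.outs a.head, W a b) / (hX.outs a.head).card)
  have hfin := finite_dartEval_ne_zero ω.2.1
  have hu : u.support.Finite := by
    -- The grand mean spreads a nonzero entry over all targets of its block, which are still finite
    -- in number.
    have hfin' : (⋃ p ∈ {p : OrientedPath X (n + 1 + 1) × OrientedPath X (n + 1 + 1) |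
        dartEval (tower X (n + 1 + 1)) p.1 p.2 ω.1 ≠ 0},
        (hX.outs p.2.tail : Set (OrientedPath X (n + 1 + 1)))).Finite :=
      hfin.biUnion fun p _ => Finset.finite_toSet _
    refine hfin'.subset fun b hb => ?_
    by_contra hb'
    simp only [Set.mem_iUnion, not_exists, Finset.mem_coe, hX.mem_outs] at hb'
    have hW : ∀ a b', b'.tail = b.tail → W a b' = 0 := fun a b' h => by
      by_contra hW
      exact hb' (a, b') hW h.symm
    refine hb ?_
    have h2 : T b.tail = 0 := by
      simp only [T]
      rw [Finset.sum_eq_zero fun b' h => Finset.sum_eq_zero fun a _ => hW a b' (hX.mem_outs.mp h),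
        zero_div]
    simp only [u]
    rw [h2, Finset.sum_eq_zero fun a _ => hW a b rfl, zero_div, sub_zero]
  have hv : v.support.Finite := by
    refine (hfin.image Prod.fst).subset fun a ha => ?_
    by_contra ha'
    refine ha ?_
    simp only [v]
    rw [Finset.sum_eq_zero fun b _ => ?_, zero_div, neg_zero]
    by_contra hW
    exact ha' ⟨(a, b), hW, rfl⟩
  obtain ⟨ω', hω'⟩ := exists_tower_cochain (X := X) (n := n + 1 + 1) (by omega)
    (w := fun x => u x.head - v x.tail) (((hu.preimage' fun c _ => hX.finite_head_preimage c).union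
      (hv.preimage' fun c _ => hX.finite_tail_preimage c)).subset fun x hx => by
        by_contra h
        simp only [Set.mem_union, Set.mem_preimage, Function.mem_support, not_or, not_not] at h
        simp [h.1, h.2] at hx)
  have hω'' : ∀ a b, a.head = b.tail →
      dartEval (tower X (n + 1 + 1)) a b ω'.1 = u b - v a := fun a b h => by
    obtain ⟨x, rfl, rfl⟩ := hX.exists_join h
    exact hω' x
  have key : ∀ a b, a.head = b.tail → dartEval (tower X (n + 1 + 1)) a b (ω - ω').1 =
      W a b - (u b - v a) := fun a b h => by
    rw [Submodule.coe_sub, map_sub, hω'' a b h]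
  refine ⟨ω - ω', ⟨fun a => ?_, fun b => ?_⟩, u, hu, v, hv, fun a b h => ?_⟩
  · rw [← row_sum_sub_averages (hX.ins_nonempty a.head) (hX.outs_nonempty a.head) W a]
    refine Finset.sum_congr rfl fun b hb => ?_
    have h := hX.mem_outs.mp hb
    rw [key a b h.symm]
    simp only [u, v, T, h, sub_neg_eq_add]
  · rw [← column_sum_sub_averages (hX.ins_nonempty b.tail) (hX.outs_nonempty b.tail) W b]
    refine Finset.sum_congr rfl fun a ha => ?_
    have h := hX.mem_ins.mp ha
    rw [key a b h]
    simp only [u, v, T, h, sub_neg_eq_add]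
  · rw [key a b h]
    simp [W]

/-- The graph morphism `X̃_{n+1} → X̃_n` sending a path to its head. -/
def headHom (n : ℕ) : tower X (n + 1) →g tower X n where
  toFun := OrientedPath.head
  map_rel' := by
    rintro _ _ ⟨x, ⟨rfl, rfl⟩ | ⟨rfl, rfl⟩⟩
    · exact tower_adj_tail_head x.head
    · exact (tower_adj_tail_head x.head).symm

include hX in
theorem finite_headHom_preimage (n : ℕ) (c : OrientedPath X n) :
    (headHom n ⁻¹' {c} : Set (OrientedPath X (n + 1))).Finite :=
  hX.finite_head_preimage c

/-- `H¹_c(X̃_n) ⊕ (harmonic cochains of X̃_{n+1}) → H¹_c(X̃_{n+1})`. -/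
def headPullCoprod (n : ℕ) :
    (H1c (tower X n) × harmonic hX n) →ₗ[ℂ] H1c (tower X (n + 1)) :=
  (H1cPull (headHom n) (finite_headHom_preimage hX n)).coprod
    ((Submodule.mkQ _).comp (harmonic hX n).subtype)

theorem headPullCoprod_mk (ζ : cochain1 (tower X n)) (η : harmonic hX n) :
    headPullCoprod hX n (Submodule.Quotient.mk ζ, η) = Submodule.Quotient.mk
      (cochain1Pull (headHom n) (finite_headHom_preimage hX n) ζ + η.1) := rfl

theorem dartEval_pull_head (ζ : cochain1 (tower X (n + 1))) {a b : OrientedPath X (n + 1 + 1)}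
    (h : a.head = b.tail) : dartEval (tower X (n + 1 + 1)) a b
      (cochain1Pull (headHom (n + 1)) (finite_headHom_preimage hX (n + 1)) ζ).1 =
        dartEval (tower X (n + 1)) b.tail b.head ζ.1 := by
  refine (dartEval_cochain1Pull (headHom (n + 1)) _ ζ (hX.tower_adj h)).trans ?_
  change dartEval (tower X (n + 1)) a.head b.head ζ.1 = _
  rw [h]

theorem coboundary_symm {V : Type*} {Γ : SimpleGraph V} (f : V → ℂ) (a : Γ.Dart) :
    coboundary Γ f a = - coboundary Γ f a.symm := by
  simp [coboundary]

/-- If the sum is `df`, then on each block `η` equals `(f b - ζ b) - f a`, so `η = 0`. Now `f a = f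
b - ζ b` for every `b` with `b.tail = a.head`, so `f` depends only on the head and descends to a
primitive of `ζ`. -/
theorem headPullCoprod_injective : Function.Injective (headPullCoprod hX (n + 1)) := by
  rw [injective_iff_map_eq_zero]
  rintro ⟨z, η, hη⟩ h
  obtain ⟨ζ, rfl⟩ := Submodule.Quotient.mk_surjective _ z
  rw [headPullCoprod_mk, H1c_mk_eq_zero_iff] at h
  obtain ⟨f, hf, hfω⟩ := h
  have hf' : f.support.Finite := hf
  have key : ∀ a b, a.head = b.tail → dartEval (tower X (n + 1)) b.tail b.head ζ.1 +
      dartEval (tower X (n + 1 + 1)) a b η.1 = f b - f a := fun a b h => by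
    rw [← dartEval_coboundary (hX.tower_adj h), hfω, Submodule.coe_add, map_add,
      dartEval_pull_head hX ζ h]
  have hη0 : ∀ a b, a.head = b.tail → dartEval (tower X (n + 1 + 1)) a b η.1 = 0 := fun a b h =>
    harmonic_eq_zero hX hη (u := fun b => f b - dartEval (tower X (n + 1)) b.tail b.head ζ.1)
      (v := f) b.tail (fun a b' ha hb => by
        rw [sub_right_comm, ← key a b' (ha.trans hb.symm)]; ring) h rfl
  have hη1 : η = 0 := Subtype.ext <| tower_cochain_ext_pairs η.2.2 (by simp) fun a b h => by
    rw [hη0 a b h, Submodule.coe_zero, map_zero]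
  choose l hl using fun c : OrientedPath X (n + 1) => hX.exists_head_eq c
  have hfl : ∀ a, f a = f (l a.head) := fun a => by
    obtain ⟨b, hb⟩ := hX.exists_tail_eq a.head
    have h1 := key a b hb.symm
    have h2 := key (l a.head) b ((hl _).trans hb.symm)
    rw [hη0 _ _ hb.symm] at h1
    rw [hη0 _ _ ((hl _).trans hb.symm), h1] at h2
    exact sub_right_injective h2
  have hζ : (Submodule.Quotient.mk ζ : H1c (tower X (n + 1))) = 0 := by
    rw [H1c_mk_eq_zero_iff]
    refine ⟨fun c => f (l c), ?_, ?_⟩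
    · refine (hf'.image OrientedPath.head).subset fun c hc => ⟨l c, hc, hl c⟩
    · refine tower_cochain_ext (coboundary_symm _) ζ.2.2 fun b => ?_
      rw [dartEval_coboundary (tower_adj_tail_head b), ← hfl b]
      have := key (l b.tail) b (hl _)
      rw [hη0 _ _ (hl _), add_zero] at this
      exact this.symm
  exact Prod.ext hζ (Subtype.ext hη1)

/-- Modulo the coboundary of `v`, the non-harmonic part `u b - v a` is `(u - v) b`, the pull-back of
the cochain with value `u - v` on the edges `b` of the lower graph. -/
theorem headPullCoprod_surjective : Function.Surjective (headPullCoprod hX (n + 1)) := by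
  intro z
  obtain ⟨ω, rfl⟩ := Submodule.Quotient.mk_surjective _ z
  obtain ⟨η, hη, u, hu, v, hv, h⟩ := exists_harmonic_decomposition hX ω
  obtain ⟨ζ, hζ⟩ := exists_tower_cochain (X := X) (n := n + 1) (by omega) (w := u - v)
    (Submodule.sub_mem _ hu hv : u - v ∈ cochain0 _)
  refine ⟨(Submodule.Quotient.mk ζ, ⟨η, hη⟩), ?_⟩
  rw [headPullCoprod_mk, eq_comm, H1c_mk_eq_iff]
  refine ⟨v, hv, tower_cochain_ext_pairs (coboundary_symm _)
    (Submodule.sub_mem _ ω.2 (Submodule.add_mem _ (Subtype.prop _) η.2)).2 fun a b hab => ?_⟩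
  rw [dartEval_coboundary (hX.tower_adj hab), Submodule.coe_add, map_sub, map_add, h a b hab,
    dartEval_pull_head hX ζ hab, hζ, Pi.sub_apply]
  ring

/-- `H¹_c(X̃_n) ⊕ (harmonic cochains of X̃_{n+1}) ≃ H¹_c(X̃_{n+1})` for `n ≥ 1`. -/
def headPullEquiv (n : ℕ) :
    (H1c (tower X (n + 1)) × harmonic hX (n + 1)) ≃ₗ[ℂ] H1c (tower X (n + 1 + 1)) :=
  LinearEquiv.ofBijective (headPullCoprod hX (n + 1))
    ⟨headPullCoprod_injective hX, headPullCoprod_surjective hX⟩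

theorem headPullEquiv_equivariant {H : Type*} [Group H] [MulAction H V] [GraphAction H X] (h : H)
    (z : H1c (tower X (n + 1)) × harmonic hX (n + 1)) :
    headPullEquiv hX n (((H1cRep H (tower X (n + 1))).prod (harmonicRep hX H (n + 1))) h z) =
      H1cRep H (tower X (n + 1 + 1)) h (headPullEquiv hX n z) := by
  obtain ⟨z, η⟩ := z
  change H1cPull (headHom (n + 1)) _ (H1cRep H (tower X (n + 1)) h z) +
    H1cRep H (tower X (n + 1 + 1)) h (Submodule.Quotient.mk η.1) =
      H1cRep H (tower X (n + 1 + 1)) h (H1cPull (headHom (n + 1)) _ z + Submodule.Quotient.mk η.1)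
  rw [map_add]
  congr 1
  exact H1cPull_equivariant (MonoidHom.id H) (headHom (n + 1)) _ (fun _ _ => rfl) h z

end Harmonic

/-! ### Cohomology of the fibre over an edge -/

section Fibre

variable {V : Type*} {X : SimpleGraph V} (hX : LeaflessTree X) {k : ℕ}

/-- The middle edge of a path of odd length. -/
def midEdge (c : OrientedPath X (2 * k + 1)) : Sym2 V :=
  s(c.vert ⟨k, by omega⟩, c.vert ⟨k + 1, by omega⟩)

theorem midEdge_mem_edgeSet (c : OrientedPath X (2 * k + 1)) : midEdge c ∈ X.edgeSet :=
  c.adj ⟨k, by omega⟩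

theorem midEdge_smul {H : Type*} [Group H] [MulAction H V] [GraphAction H X] (h : H)
    (c : OrientedPath X (2 * k + 1)) : midEdge (h • c) = (midEdge c).map (h • ·) := rfl

/-- This separates sources from targets in a fibre: `a` is a source over the middle edge of its head
and a target over that of its tail. -/
theorem midEdge_tail_ne_midEdge_head (a : OrientedPath X (2 * k + 1 + 1)) :
    midEdge a.tail ≠ midEdge a.head := by
  intro h
  rcases Sym2.eq_iff.mp h with ⟨h1, -⟩ | ⟨h1, -⟩
  · exact absurd (congrArg Fin.val (a.injective h1)) (by simp)
  · exact absurd (congrArg Fin.val (a.injective h1)) (by simp; omega)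

/-- The centres of `a` and `b` are the two central vertices of their overlap, so a whole block lies
over one edge of `X`. -/
theorem proj_pair_eq_midEdge {a b : OrientedPath X (2 * k + 1 + 1)} (h : a.head = b.tail) :
    s(proj X (k + 1) a, proj X (k + 1) b) = midEdge b.tail := by
  have : a.head.vert ⟨k, by omega⟩ = b.tail.vert ⟨k, by omega⟩ :=
    congrFun (congrArg OrientedPath.vert h) _
  exact congrArg (fun x => s(x, proj X (k + 1) b)) this

/-- The inclusion of the fibre over an edge. -/
def fibreHom (k : ℕ) (e : Sym2 V) : (fibre X (k + 1) e).coe →g tower X (2 * k + 1 + 1) :=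
  (fibre X (k + 1) e).hom

theorem fibreHom_injective (e : Sym2 V) : Function.Injective (fibreHom (X := X) k e) :=
  Subtype.val_injective

theorem finite_fibreHom_preimage (e : Sym2 V) (v : OrientedPath X (2 * k + 1 + 1)) :
    (fibreHom (X := X) k e ⁻¹' {v}).Finite :=
  (Set.finite_singleton v).preimage (fibreHom_injective e).injOn

/-- Restriction to the fibre over an edge. -/
def fibreRestrict (k : ℕ) (e : Sym2 V) :
    H1c (tower X (2 * k + 1 + 1)) →ₗ[ℂ] H1c (fibre X (k + 1) e).coe :=
  H1cPull (fibreHom k e) (finite_fibreHom_preimage e)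

include hX in
theorem fibre_adj {e : Sym2 V} {a b : OrientedPath X (2 * k + 1 + 1)} (h : a.head = b.tail)
    (he : midEdge b.tail = e) : (fibre X (k + 1) e).Adj a b :=
  ⟨hX.tower_adj h, (proj_pair_eq_midEdge h).trans he⟩

theorem fibre_adj_cases {e : Sym2 V} {a b : OrientedPath X (2 * k + 1 + 1)}
    (h : (fibre X (k + 1) e).Adj a b) :
    (a.head = b.tail ∧ midEdge b.tail = e) ∨ (b.head = a.tail ∧ midEdge a.tail = e) := by
  obtain ⟨⟨x, ⟨rfl, rfl⟩ | ⟨rfl, rfl⟩⟩, he⟩ := h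
  · have hx : x.tail.head = x.head.tail := rfl
    exact Or.inl ⟨hx, (proj_pair_eq_midEdge hx).symm.trans he⟩
  · have hx : x.tail.head = x.head.tail := rfl
    exact Or.inr ⟨hx, (proj_pair_eq_midEdge hx).symm.trans (Sym2.eq_swap.trans he)⟩

/-- Two cochains on the fibre agree as soon as they agree on positively oriented edges. -/
theorem fibre_cochain_ext {e : Sym2 V} {ω ω' : (fibre X (k + 1) e).coe.Dart → ℂ}
    (hω : ∀ a, ω a = - ω a.symm) (hω' : ∀ a, ω' a = - ω' a.symm)
    (h : ∀ a b : (fibre X (k + 1) e).verts, (fibre X (k + 1) e).coe.Adj a b →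
      (fibreHom k e a).head = (fibreHom k e b).tail → midEdge (fibreHom k e b).tail = e →
      dartEval (fibre X (k + 1) e).coe a b ω = dartEval (fibre X (k + 1) e).coe a b ω') :
    ω = ω' := by
  funext d
  rcases fibre_adj_cases (a := fibreHom k e d.fst) (b := fibreHom k e d.snd) d.adj with
    ⟨h1, h2⟩ | ⟨h1, h2⟩
  · have := h d.fst d.snd d.adj h1 h2
    rwa [dartEval_of_adj d.adj, dartEval_of_adj d.adj] at this
  · have := h d.snd d.fst d.adj.symm h1 h2
    rw [dartEval_of_adj d.adj.symm, dartEval_of_adj d.adj.symm] at this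
    rw [hω, hω']
    exact congrArg Neg.neg this

theorem dartEval_fibre_pull {e : Sym2 V} (ω : cochain1 (tower X (2 * k + 1 + 1)))
    {a b : (fibre X (k + 1) e).verts} (h : (fibre X (k + 1) e).coe.Adj a b) :
    dartEval (fibre X (k + 1) e).coe a b
      (cochain1Pull (fibreHom k e) (finite_fibreHom_preimage e) ω).1 =
        dartEval (tower X (2 * k + 1 + 1)) (fibreHom k e a) (fibreHom k e b) ω.1 :=
  dartEval_cochain1Pull (fibreHom k e) _ ω h

/-- The class of a cochain on the fibre over `e` depends only on its values on the positively
oriented edges over `e`. -/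
theorem fibreRestrict_mk_congr {e : Sym2 V} {ω ω' : cochain1 (tower X (2 * k + 1 + 1))}
    (h : ∀ a b, a.head = b.tail → midEdge b.tail = e →
      dartEval (tower X (2 * k + 1 + 1)) a b ω.1 = dartEval (tower X (2 * k + 1 + 1)) a b ω'.1) :
    fibreRestrict k e (Submodule.Quotient.mk ω) = fibreRestrict k e (Submodule.Quotient.mk ω') := by
  refine congrArg Submodule.Quotient.mk (Subtype.ext ?_)
  refine fibre_cochain_ext
    (cochain1Pull (fibreHom k e) (finite_fibreHom_preimage e) ω).2.2
    (cochain1Pull (fibreHom k e) (finite_fibreHom_preimage e) ω').2.2 fun a b hadj hab he => ?_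
  rw [dartEval_fibre_pull ω hadj, dartEval_fibre_pull ω' hadj, h _ _ hab he]

/-- Lift a representative to the whole graph and keep its harmonic part. The discarded part `u b - v
a` restricts to a coboundary on the fibre. -/
theorem exists_harmonic_fibreRestrict_eq (e : Sym2 V) (y : H1c (fibre X (k + 1) e).coe) :
    ∃ η ∈ harmonic hX (2 * k + 1), fibreRestrict k e (Submodule.Quotient.mk η) = y := by
  obtain ⟨κ, rfl⟩ := Submodule.Quotient.mk_surjective _ y
  obtain ⟨ω, rfl⟩ := cochain1Pull_surjective (fibreHom k e) (finite_fibreHom_preimage e)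
    (fibreHom_injective e) κ
  obtain ⟨η, hη, u, hu, v, hv, h⟩ := exists_harmonic_decomposition hX ω
  refine ⟨η, hη, Eq.symm ?_⟩
  classical
  -- The primitive is `u` on targets and `v` on sources, consistent because no vertex of the fibre
  -- is both.
  refine H1c_mk_eq_iff.mpr ⟨fun x => if midEdge (fibreHom k e x).tail = e then
    u (fibreHom k e x) else v (fibreHom k e x), ?_, ?_⟩
  · have hu' : u.support.Finite := hu
    have hv' : v.support.Finite := hv
    refine ((hu'.union hv').preimage (fibreHom_injective e).injOn).subset fun x hx => ?_
    by_contra hx'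
    simp only [Set.mem_preimage, Set.mem_union, Function.mem_support, not_or, not_not] at hx'
    refine hx ?_
    simp only
    split_ifs
    exacts [hx'.1, hx'.2]
  · refine fibre_cochain_ext (coboundary_symm _)
      (cochain1Pull (fibreHom k e) (finite_fibreHom_preimage e) ω -
        cochain1Pull (fibreHom k e) (finite_fibreHom_preimage e) η).2.2 fun a b hadj hab he => ?_
    have hne : midEdge (fibreHom k e a).tail ≠ e := fun h' =>
      midEdge_tail_ne_midEdge_head (fibreHom k e a) (by rw [h', hab, he])
    rw [dartEval_coboundary hadj, map_sub, dartEval_fibre_pull ω hadj]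
    refine (?_ : _ = _ - _).trans (congrArg _ (dartEval_fibre_pull η hadj).symm)
    rw [h _ _ hab, if_pos he, if_neg hne]
    ring

theorem harmonic_eq_zero_of_fibreRestrict {e : Sym2 V}
    {η : cochain1 (tower X (2 * k + 1 + 1))} (hη : η ∈ harmonic hX (2 * k + 1))
    (h : fibreRestrict k e (Submodule.Quotient.mk η) = 0)
    {a b : OrientedPath X (2 * k + 1 + 1)} (hab : a.head = b.tail) (he : midEdge b.tail = e) :
    dartEval (tower X (2 * k + 1 + 1)) a b η.1 = 0 := by
  classical
  obtain ⟨f, -, hf⟩ := H1c_mk_eq_zero_iff.mp h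
  -- Extension by zero; all vertices of the blocks over `e` lie in the fibre, so the default is
  -- never read.
  let f' : OrientedPath X (2 * k + 1 + 1) → ℂ := fun x =>
    if hx : x ∈ (fibre X (k + 1) e).verts then f ⟨x, hx⟩ else 0
  refine harmonic_eq_zero hX hη (u := f') (v := f') b.tail (fun a' b' ha hb => ?_) hab rfl
  have hadj := fibre_adj hX (e := e) (ha.trans hb.symm) (by rw [hb, he])
  have ha' : a' ∈ (fibre X (k + 1) e).verts := (fibre X (k + 1) e).edge_vert hadj
  have hb' : b' ∈ (fibre X (k + 1) e).verts := (fibre X (k + 1) e).edge_vert hadj.symm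
  have hadj' : (fibre X (k + 1) e).coe.Adj ⟨a', ha'⟩ ⟨b', hb'⟩ := hadj
  have := congrArg (dartEval (fibre X (k + 1) e).coe ⟨a', ha'⟩ ⟨b', hb'⟩) hf
  rw [dartEval_coboundary hadj'] at this
  simp only [f']
  rw [dif_pos ha', dif_pos hb', this]
  exact (dartEval_fibre_pull η hadj').symm

end Fibre

/-! ### Open stabilizers and smoothness -/

section Smooth

variable {V : Type*} {G : Type*} [Group G] [TopologicalSpace G]
  [MulAction G V]

theorem exists_open_subgroup_fixing {Γ : SimpleGraph V} [GraphAction G Γ]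
    (hΓ : ∀ v : V, IsOpen (MulAction.stabilizer G v : Set G)) (ω : cochain1 Γ) :
    ∃ U : Subgroup G, IsOpen (U : Set G) ∧ ∀ u ∈ U, cochain1Rep G Γ u ω = ω := by
  have : Finite ω.1.support := ω.2.1
  have hfix : ∀ {u : G} {d : Γ.Dart}, u • d.fst = d.fst → u • d.snd = d.snd → u⁻¹ • d = d :=
    fun {u d} h1 h2 => inv_smul_eq_iff.mpr (SimpleGraph.Dart.ext _ _ (Prod.ext h1.symm h2.symm))
  refine ⟨⨅ d : ω.1.support, MulAction.stabilizer G d.1.fst ⊓ MulAction.stabilizer G d.1.snd,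
    ?_, fun u hu => Subtype.ext (funext fun a => ?_)⟩
  · rw [Subgroup.coe_iInf]
    exact isOpen_iInter_of_finite fun d => (hΓ _).inter (hΓ _)
  · rw [Subgroup.mem_iInf] at hu
    change ω.1 (u⁻¹ • a) = ω.1 a
    -- If `u⁻¹ • a` lies in the support, `u` fixes it, hence it equals `a`; so `u` cannot move a
    -- zero of `ω` into the support.
    by_cases ha : ω.1 a = 0
    · by_contra ha'
      rw [ha] at ha'
      have h := hu ⟨_, ha'⟩
      have h' : u⁻¹ • u⁻¹ • a = u⁻¹ • a := hfix h.1 h.2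
      rw [(MulAction.injective u⁻¹) h', ha] at ha'
      exact ha' rfl
    · have h := hu ⟨a, ha⟩
      rw [hfix h.1 h.2]

variable {X : SimpleGraph V} [GraphAction G X]
  [IsTopologicalGroup G]
  (hopen : ∀ x y, X.Adj x y → IsOpen (MulAction.stabilizer G x : Set G))
include hopen

theorem isOpen_stabilizer_path {n : ℕ} (c : OrientedPath X (n + 1)) :
    IsOpen (MulAction.stabilizer G c : Set G) := by
  have h : ∀ i, IsOpen (MulAction.stabilizer G (c.vert i) : Set G) := fun i => by
    refine Fin.lastCases ?_ (fun i => ?_) i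
    · exact hopen _ _ (c.adj (Fin.last n)).symm
    · exact hopen _ _ (c.adj i)
  refine Subgroup.isOpen_mono (H₁ := ⨅ i, MulAction.stabilizer G (c.vert i)) (fun g hg => ?_) ?_
  · rw [Subgroup.mem_iInf] at hg
    exact OrientedPath.ext (funext hg)
  · rw [Subgroup.coe_iInf]
    exact isOpen_iInter_of_finite h

omit [GraphAction G X] in
theorem isOpen_edgeStabilizer {e : Sym2 V} (he : e ∈ X.edgeSet) :
    IsOpen (edgeStabilizer G e : Set G) := by
  induction e with | _ x y =>
  refine Subgroup.isOpen_mono (H₁ := MulAction.stabilizer G x ⊓ MulAction.stabilizer G y)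
    (fun g hg => ?_) ((hopen x y he).inter (hopen y x (SimpleGraph.Adj.symm he)))
  change s(g • x, g • y) = s(x, y)
  rw [show g • x = x from hg.1, show g • y = y from hg.2]

end Smooth

/-! ### Harmonic cochains as a compactly induced representation -/

section Induction

variable {V : Type*} {X : SimpleGraph V} (hX : LeaflessTree X) {k : ℕ}
  {G : Type*} [Group G] [MulAction G V]

theorem map_mul_smul (g h : G) (e : Sym2 V) :
    e.map ((g * h) • ·) = (e.map (h • ·)).map (g • ·) := by
  rw [Sym2.map_map]
  exact congrArg (fun φ : V → V => e.map φ) (funext fun x => mul_smul g h x)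

theorem map_inv_smul_eq {g : G} {e e' : Sym2 V} (h : e.map (g • ·) = e') :
    e'.map (g⁻¹ • ·) = e := by
  rw [← h, ← map_mul_smul, inv_mul_cancel]
  simp

variable [GraphAction G X]

theorem fibreRestrict_edgeStabilizer {e : Sym2 V} (h : edgeStabilizer G e)
    (z : H1c (tower X (2 * k + 1 + 1))) :
    fibreRestrict k e (H1cRep G (tower X (2 * k + 1 + 1)) h z) =
      H1cRep (edgeStabilizer G e) (fibre X (k + 1) e).coe h (fibreRestrict k e z) :=
  H1cPull_equivariant (edgeStabilizer G e).subtype (fibreHom k e) (finite_fibreHom_preimage e)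
    (fun _ _ => rfl) h z

/-- `z ↦ (g ↦ restriction of g z to the fibre over e₀)`. -/
def fibreTransform (k : ℕ) (e₀ : Sym2 V) :
    H1c (tower X (2 * k + 1 + 1)) →ₗ[ℂ] (G → H1c (fibre X (k + 1) e₀).coe) :=
  LinearMap.pi fun g => (fibreRestrict k e₀).comp (H1cRep G (tower X (2 * k + 1 + 1)) g)

theorem fibreTransform_apply (e₀ : Sym2 V) (z : H1c (tower X (2 * k + 1 + 1))) (g : G) :
    fibreTransform k e₀ z g = fibreRestrict k e₀ (H1cRep G (tower X (2 * k + 1 + 1)) g z) := rfl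

theorem H1cRep_mk {Γ : SimpleGraph V} [GraphAction G Γ] (g : G) (ω : cochain1 Γ) :
    H1cRep G Γ g (Submodule.Quotient.mk ω) = Submodule.Quotient.mk (cochain1Rep G Γ g ω) := rfl

theorem dartEval_cochain1Rep {Γ : SimpleGraph V} [GraphAction G Γ] (g : G) (ω : cochain1 Γ)
    (a b : V) : dartEval Γ a b (cochain1Rep G Γ g ω).1 =
      dartEval Γ (g⁻¹ • a) (g⁻¹ • b) ω.1 :=
  dartEval_funRep g a b ω.1

variable [TopologicalSpace G] [IsTopologicalGroup G]
  (htrans : ∀ e ∈ X.edgeSet, ∀ e' ∈ X.edgeSet, ∃ g : G, e.map (g • ·) = e')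
  (hopen : ∀ x y, X.Adj x y → IsOpen (MulAction.stabilizer G x : Set G))
  {e₀ : Sym2 V} (he₀ : e₀ ∈ X.edgeSet)

include htrans hopen he₀ in
theorem fibreTransform_mem (z : H1c (tower X (2 * k + 1 + 1))) :
    fibreTransform (G := G) k e₀ z ∈ cIndSpace (edgeStabilizer G e₀)
      (H1cRep (edgeStabilizer G e₀) (fibre X (k + 1) e₀).coe) := by
  obtain ⟨ω, rfl⟩ := Submodule.Quotient.mk_surjective _ z
  refine ⟨fun h g => ?_, ?_, ?_⟩
  · rw [fibreTransform_apply, fibreTransform_apply, map_mul]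
    exact fibreRestrict_edgeStabilizer h
      (H1cRep G (tower X (2 * k + 1 + 1)) g (Submodule.Quotient.mk ω))
  · obtain ⟨U, hU, hUω⟩ := exists_open_subgroup_fixing (G := G) (Γ := tower X (2 * k + 1 + 1))
      (isOpen_stabilizer_path hopen) ω
    refine ⟨U, hU, fun u hu g => ?_⟩
    rw [fibreTransform_apply, fibreTransform_apply, map_mul, Module.End.mul_apply,
      H1cRep_mk (Γ := tower X (2 * k + 1 + 1)) u ω, hUω u hu]
  -- The restriction of `g ω` over `e₀` sees `ω` over `g⁻¹ e₀`. It vanishes unless `g⁻¹ e₀` is one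
  -- of the finitely many edges `e` below the support, and then `g` lies in the coset of `t e`.
  · choose! t ht using fun e (he : e ∈ X.edgeSet) => htrans e he e₀ he₀
    let E : Set G := (fun p : OrientedPath X (2 * k + 1 + 1) × OrientedPath X (2 * k + 1 + 1) =>
      t (midEdge p.2.tail)) '' {p | dartEval (tower X (2 * k + 1 + 1)) p.1 p.2 ω.1 ≠ 0}
    refine ⟨E, ((finite_dartEval_ne_zero ω.2.1).image _).isCompact, fun g hg => ?_⟩
    by_contra hgE
    refine hg ?_
    rw [fibreTransform_apply, H1cRep_mk, ← map_zero (fibreRestrict k e₀),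
      ← Submodule.Quotient.mk_zero]
    refine fibreRestrict_mk_congr fun a b hab he => ?_
    rw [Submodule.coe_zero, map_zero, dartEval_cochain1Rep]
    by_contra hne
    refine hgE ⟨g * (t (midEdge (g⁻¹ • b).tail))⁻¹, ?_, _, ⟨(g⁻¹ • a, g⁻¹ • b), hne, rfl⟩,
      inv_mul_cancel_right _ _⟩
    change e₀.map _ = e₀
    have h1 : (midEdge (g⁻¹ • b).tail) = e₀.map (g⁻¹ • ·) := by
      rw [OrientedPath.smul_tail, midEdge_smul, he]
    rw [map_mul_smul, map_inv_smul_eq (ht _ (midEdge_mem_edgeSet _)), h1,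
      ← map_mul_smul, mul_inv_cancel]
    simp

/-- Harmonic cochains as compactly induced functions. -/
def harmonicToCInd : harmonic hX (2 * k + 1) →ₗ[ℂ] cIndSpace (edgeStabilizer G e₀)
      (H1cRep (edgeStabilizer G e₀) (fibre X (k + 1) e₀).coe) :=
  ((fibreTransform (G := G) k e₀).codRestrict _ (fibreTransform_mem htrans hopen he₀)).comp
    ((Submodule.mkQ _).comp (harmonic hX (2 * k + 1)).subtype)

theorem harmonicToCInd_apply (η : harmonic hX (2 * k + 1)) (g : G) :
    (harmonicToCInd hX htrans hopen he₀ η).1 g =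
      fibreRestrict k e₀ (Submodule.Quotient.mk (cochain1Rep G _ g η.1)) := rfl

/-- Any block can be translated over `e₀`, where a harmonic cochain with trivial class vanishes. -/
theorem harmonicToCInd_injective :
    Function.Injective (harmonicToCInd (k := k) hX htrans hopen he₀) := by
  rw [injective_iff_map_eq_zero]
  intro η h
  refine Subtype.ext (Subtype.ext ?_)
  refine tower_cochain_ext_pairs η.1.2.2 (by simp) fun a b hab => ?_
  obtain ⟨g, hg⟩ := htrans _ (midEdge_mem_edgeSet b.tail) e₀ he₀
  have h0 : fibreRestrict k e₀ (Submodule.Quotient.mk (cochain1Rep G _ g η.1)) = 0 :=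
    congrFun (congrArg Subtype.val h) g
  have h1 := harmonic_eq_zero_of_fibreRestrict hX (cochain1Rep_mem_harmonic hX g η.2) h0
    (a := g • a) (b := g • b) (congrArg (g • ·) hab) hg
  rw [dartEval_cochain1Rep, inv_smul_smul, inv_smul_smul] at h1
  rw [h1]
  simp

/-- For each edge `e`, lift `f (t e)` to a harmonic cochain, move it back by `(t e)⁻¹`, and keep
only its blocks over `e`. Harmonicity is a condition on single blocks, so these pieces glue. -/
theorem harmonicToCInd_surjective :
    Function.Surjective (harmonicToCInd (k := k) hX htrans hopen he₀) := by
  rintro ⟨f, hf1, hf2, C, hC, hfC⟩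
  choose! t ht using fun e (he : e ∈ X.edgeSet) => htrans e he e₀ he₀
  -- The lift of `0` is normalised to `0` so that the glued cochain has finite support.
  have hκ : ∀ y : H1c (fibre X (k + 1) e₀).coe, ∃ η ∈ harmonic hX (2 * k + 1),
      fibreRestrict k e₀ (Submodule.Quotient.mk η) = y ∧ (y = 0 → η = 0) := fun y => by
    by_cases hy : y = 0
    · exact ⟨0, Submodule.zero_mem _, by rw [hy, Submodule.Quotient.mk_zero, map_zero],
        fun _ => rfl⟩
    · obtain ⟨η, hη, h⟩ := exists_harmonic_fibreRestrict_eq hX e₀ y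
      exact ⟨η, hη, h, fun h => absurd h hy⟩
  choose κ hκ hκf hκ0 using hκ
  let τ : Sym2 V → cochain1 (tower X (2 * k + 1 + 1)) := fun e =>
    cochain1Rep G _ (t e)⁻¹ (κ (f (t e)))
  have hτ : ∀ e, τ e ∈ harmonic hX (2 * k + 1) := fun e =>
    cochain1Rep_mem_harmonic hX _ (hκ _)
  -- The stabilizer is open, so `C` meets finitely many of its right cosets, and `e = (t e)⁻¹ e₀`
  -- depends only on the coset of `t e`.
  have hfin : {e ∈ X.edgeSet | f (t e) ≠ 0}.Finite := by
    have hK : IsOpen (edgeStabilizer G e₀ : Set G) := isOpen_edgeStabilizer hopen he₀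
    obtain ⟨s, hs⟩ := hC.elim_finite_subcover (fun c : G => (edgeStabilizer G e₀ : Set G) * {c})
      (fun c => hK.mul_right) fun c _ => Set.mem_iUnion.mpr ⟨c, 1, one_mem _, c, rfl, one_mul c⟩
    refine (s.finite_toSet.image fun c => e₀.map (c⁻¹ • ·)).subset fun e ⟨he, hfe⟩ => ?_
    obtain ⟨h, hh, c, hc, hhc⟩ := hfC hfe
    obtain ⟨c', hc', h', hh', c'', hc'', hhc'⟩ := Set.mem_iUnion₂.mp (hs hc)
    refine ⟨c', hc', ?_⟩
    have hc3 : c'' = c' := hc''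
    subst hc3
    have e1 : h * h' * c'' = t e := by
      rw [mul_assoc, show h' * c'' = c from hhc']
      exact hhc
    refine map_inv_smul_eq ?_
    have hmem := (edgeStabilizer G e₀).inv_mem ((edgeStabilizer G e₀).mul_mem hh hh')
    rw [show c'' = (h * h')⁻¹ * t e by rw [← e1]; group, map_mul_smul, ht e he]
    exact hmem
  obtain ⟨ω, hω⟩ := exists_tower_cochain (X := X) (n := 2 * k + 1 + 1) (by omega)
    (w := fun x => dartEval (tower X (2 * k + 1 + 1)) x.tail x.head (τ (midEdge x.head.tail)).1) (by
      have hfin' := hfin.biUnion fun e _ => finite_dartEval_ne_zero (τ e).2.1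
      refine Set.Finite.of_finite_image (f := fun x => (x.tail, x.head)) (hfin'.subset ?_)
        fun x _ y _ hxy => tower_edge_unique X (by omega) x y
          (Or.inl ⟨congrArg Prod.fst hxy, congrArg Prod.snd hxy⟩)
      rintro _ ⟨x, hx, rfl⟩
      refine Set.mem_biUnion (x := midEdge x.head.tail) ⟨midEdge_mem_edgeSet _, fun h0 => hx ?_⟩ hx
      simp only [τ]
      rw [hκ0 _ h0, map_zero, Submodule.coe_zero, map_zero])
  have hω' : ∀ a b, a.head = b.tail → dartEval (tower X (2 * k + 1 + 1)) a b ω.1 =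
      dartEval (tower X (2 * k + 1 + 1)) a b (τ (midEdge b.tail)).1 := fun a b h => by
    obtain ⟨x, rfl, rfl⟩ := hX.exists_join h
    exact hω x
  refine ⟨⟨ω, fun a => ?_, fun b => ?_⟩, Subtype.ext (funext fun g => ?_)⟩
  · rw [← (hτ (midEdge a.head)).1 a]
    refine Finset.sum_congr rfl fun b hb => ?_
    rw [hω' a b (hX.mem_outs.mp hb).symm, hX.mem_outs.mp hb]
  · rw [← (hτ (midEdge b.tail)).2 b]
    exact Finset.sum_congr rfl fun a ha => hω' a b (hX.mem_ins.mp ha)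
  · rw [harmonicToCInd_apply]
    change _ = f g
    set e := e₀.map (g⁻¹ • ·) with he
    have hge : e.map (g • ·) = e₀ := by
      rw [he, ← map_mul_smul, mul_inv_cancel]; simp
    have heX : e ∈ X.edgeSet := by
      rw [he]
      clear_value e
      induction e₀ with | _ x y => exact GraphAction.adj_smul _ _ _ he₀
    -- With `e = g⁻¹ e₀`, both `g` and `t e` carry `e` to `e₀`; the equivariance of `f` then
    -- determines `f g` from `f (t e)`.
    have hk : g * (t e)⁻¹ ∈ edgeStabilizer G e₀ := by
      change e₀.map _ = e₀
      rw [map_mul_smul, map_inv_smul_eq (ht e heX), hge]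
    have h1 : f g = fibreRestrict k e₀ (H1cRep G (tower X (2 * k + 1 + 1)) (g * (t e)⁻¹)
        (Submodule.Quotient.mk (κ (f (t e))))) := by
      rw [fibreRestrict_edgeStabilizer ⟨_, hk⟩, hκf, ← hf1]
      congr 1
      simp
    rw [h1, map_mul]
    refine fibreRestrict_mk_congr (ω' := cochain1Rep G _ g (τ e)) fun a b hab hb => ?_
    rw [dartEval_cochain1Rep, dartEval_cochain1Rep, hω' (g⁻¹ • a) (g⁻¹ • b) (congrArg (g⁻¹ • ·) hab),
      OrientedPath.smul_tail, midEdge_smul, hb]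

/-- Harmonic cochains on `X̃_{2k+2}` form the representation compactly induced from the cohomology
of the fibre over an edge. -/
def harmonicEquivCInd : harmonic hX (2 * k + 1) ≃ₗ[ℂ] cIndSpace (edgeStabilizer G e₀)
      (H1cRep (edgeStabilizer G e₀) (fibre X (k + 1) e₀).coe) :=
  LinearEquiv.ofBijective (harmonicToCInd hX htrans hopen he₀)
    ⟨harmonicToCInd_injective hX htrans hopen he₀, harmonicToCInd_surjective hX htrans hopen he₀⟩

theorem harmonicEquivCInd_equivariant (g : G) (η : harmonic hX (2 * k + 1)) :
    harmonicEquivCInd hX htrans hopen he₀ (harmonicRep hX G (2 * k + 1) g η) =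
      cInd (edgeStabilizer G e₀) (H1cRep (edgeStabilizer G e₀) (fibre X (k + 1) e₀).coe) g
        (harmonicEquivCInd hX htrans hopen he₀ η) := by
  refine Subtype.ext (funext fun x => ?_)
  change fibreRestrict k e₀ (Submodule.Quotient.mk (cochain1Rep G _ x (cochain1Rep G _ g η.1))) =
    fibreRestrict k e₀ (Submodule.Quotient.mk (cochain1Rep G _ (x * g) η.1))
  rw [map_mul]
  rfl

theorem nonempty_equiv_prod {A B C L : Type*} [AddCommMonoid A] [Module ℂ A] [AddCommMonoid B]
    [Module ℂ B] [AddCommMonoid C] [Module ℂ C] [AddCommMonoid L] [Module ℂ L] {H : Type*} [Group H]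
    {ρA : Representation ℂ H A} {ρB : Representation ℂ H B} {ρC : Representation ℂ H C}
    {ρL : Representation ℂ H L} (φ : (A × B) ≃ₗ[ℂ] L)
    (hφ : ∀ h z, φ ((ρA.prod ρB) h z) = ρL h (φ z)) (ψ : B ≃ₗ[ℂ] C)
    (hψ : ∀ h b, ψ (ρB h b) = ρC h (ψ b)) : Nonempty (ρL.Equiv (ρA.prod ρC)) := by
  refine ⟨Representation.Equiv.mk (φ.symm ≪≫ₗ (LinearEquiv.refl ℂ A).prodCongr ψ) fun h =>
    LinearMap.ext fun z => ?_⟩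
  obtain ⟨⟨a, b⟩, rfl⟩ := φ.surjective z
  simp only [LinearMap.comp_apply, LinearEquiv.coe_coe, LinearEquiv.trans_apply]
  rw [← hφ, φ.symm_apply_apply, φ.symm_apply_apply]
  exact Prod.ext rfl (hψ h b)

include hX htrans hopen he₀ in
theorem nonempty_H1cRep_equiv (k : ℕ) : Nonempty
    ((H1cRep G (tower X (2 * k + 1 + 1))).Equiv ((H1cRep G (tower X (2 * k + 1))).prod
      (cInd (edgeStabilizer G e₀)
        (H1cRep (edgeStabilizer G e₀) (fibre X (k + 1) e₀).coe)))) :=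
  nonempty_equiv_prod (ρB := harmonicRep hX G (2 * k + 1))
    (headPullEquiv hX (2 * k)) (headPullEquiv_equivariant hX)
    (harmonicEquivCInd (k := k) hX htrans hopen he₀)
    (harmonicEquivCInd_equivariant hX htrans hopen he₀)

end Induction

/-! ### Application to the Bruhat–Tits tree -/

theorem tree_leaflessTree (F : Type*) [Field F] [ValuativeRel F] [TopologicalSpace F]
    [IsNonarchimedeanLocalField F] : LeaflessTree (tree F) where
  finite_neighborSet := tree_neighborSet_finite
  exists_adj_ne := tree_exists_adj_ne
  ne_of_nonbacktracking := tree_ne_of_nonbacktracking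

end BTGraph

end

theorem proposition3p5 (F : Type*) [Field F] [ValuativeRel F] [TopologicalSpace F]
    [IsNonarchimedeanLocalField F] (hF : ringChar 𝓀[F] ≠ 2) (m : ℕ) (hm : 1 ≤ m)
    (e₀ : Sym2 (BTGraph.Vertex F)) (he₀ : e₀ ∈ (BTGraph.tree F).edgeSet) :
    Nonempty
      ((BTGraph.H1cRep PGL(2, F) (BTGraph.tower (BTGraph.tree F) (2 * m))).Equiv
        ((BTGraph.H1cRep PGL(2, F) (BTGraph.tower (BTGraph.tree F) (2 * m - 1))).prod
          (BTGraph.cInd (BTGraph.edgeStabilizer PGL(2, F) e₀)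
            (BTGraph.H1cRep (BTGraph.edgeStabilizer PGL(2, F) e₀)
              (BTGraph.fibre (BTGraph.tree F) m e₀).coe)))) := by
  -- With `m = k + 1`, the indices `2 * m` and `2 * m - 1` are definitionally `2 * k + 1 + 1` and `2
  -- * k + 1`.
  obtain ⟨k, rfl⟩ := Nat.exists_eq_add_of_le' hm
  exact BTGraph.nonempty_H1cRep_equiv (G := PGL(2, F)) (BTGraph.tree_leaflessTree F)
    (fun _ he _ he' => BTGraph.tree_exists_smul_eq he he')
    (fun _ _ h => BTGraph.tree_isOpen_stabilizer h) he₀ k
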